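/- **Corollary (Gradient Descent).** An operator $\mathcal{A}=(A_1,\dots,A_k)$ is a tuple of real $m\times n$ matrices. Its size is $s(\mathcal{A})=\sum_{i}\|A_i\|_F^2$ and its error matrices are $E=s(\mathcal{A})I_m-m\sum_i A_iA_i^{*}$ and $F=s(\mathcal{A})I_n-n\sum_i A_i^{*}A_i$. It is $\varepsilon$-nearly doubly balanced if $(1-\varepsilon)\frac{s(\mathcal{A})}{m}I_m\preceq\sum_i A_iA_i^{*}\preceq(1+\varepsilon)\frac{s(\mathcal{A})}{m}I_m$ and $(1-\varepsilon)\frac{s(\mathcal{A})}{n}I_n\preceq\sum_i A_i^{*}A_i\preceq(1+\varepsilon)\frac{s(\mathcal{A})}{n}I_n$. It has a $\lambda$-spectral gap if the second largest singular value of the $m^2\times n^2$ matrix $\sum_i A_i\otimes A_i$ is at most $(1-\lambda)\,s(\mathcal{A})/\sqrt{mn}$. A scaling of $\mathcal{A}$ is an operator $(LA_1R,\dots,LA_kR)$ with $L\in\mathbb{R}^{m\times m}$ and $R\in\mathbb{R}^{n\times n}$ invertible. Gradient descent with step size $\alpha$ starts from $\mathcal{A}/\sqrt{s(\mathcal{A})}$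 (so that the initial size is one) and repeats the update $$A_i\leftarrow(I_m+\alpha E)\,A_i\,(I_n+\alpha F)\qquad(1\le i\le k),$$ where $E,F$ are the error matrices of the current operator. There are absolute constants $C,c,K>0$ such that the following holds. Let $2\le m\le n$, let $\mathcal{A}=(A_1,\dots,A_k)$ be a nonzero tuple of real $m\times n$ matrices that is $\varepsilon$-nearly doubly balanced and has a $\lambda$-spectral gap, where $\lambda>0$ and $\lambda^2\ge C\varepsilon\log m$. Then for every $0<\eta\le1$, gradient descent with step size $\alpha=c\,(m+n)^{-2}$ reaches an $\eta$-nearly doubly balanced scaling of $\mathcal{A}$ within $$K\,\frac{(n+m)^2}{\lambda}\log\frac{m+n}{\eta}$$ iterations, and all later iterates are $\eta$-nearly doubly balanced scalings of $\mathcal{A}$ as well. -/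

import Mathlib

namespace OperatorScaling

open scoped Kronecker

/-- An operator: a tuple `(A₁, …, A_k)` of real `m × n` matrices. -/
abbrev Operator (k m n : ℕ) : Type := Fin k → Matrix (Fin m) (Fin n) ℝ

variable {k m n : ℕ}

/-- The size `s(𝒜) = ∑ᵢ ‖Aᵢ‖_F²`, the sum of the squares of all entries. -/
noncomputable def size (A : Operator k m n) : ℝ :=
  ∑ i, ∑ a, ∑ b, (A i a b) ^ 2

/-- The left marginal `∑ᵢ Aᵢ Aᵢ*`. -/
noncomputable def leftMarginal (A : Operator k m n) : Matrix (Fin m) (Fin m) ℝ :=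
  ∑ i, A i * (A i).transpose

/-- The right marginal `∑ᵢ Aᵢ* Aᵢ`. -/
noncomputable def rightMarginal (A : Operator k m n) : Matrix (Fin n) (Fin n) ℝ :=
  ∑ i, (A i).transpose * A i

/-- `𝒜` is `ε`-nearly doubly balanced:
`(1 - ε) (s/m) I ≼ ∑ᵢ Aᵢ Aᵢ* ≼ (1 + ε) (s/m) I` and
`(1 - ε) (s/n) I ≼ ∑ᵢ Aᵢ* Aᵢ ≼ (1 + ε) (s/n) I` in the Loewner order. -/
def IsNearlyDoublyBalanced (ε : ℝ) (A : Operator k m n) : Prop :=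
  (leftMarginal A - ((1 - ε) * (size A / m)) • (1 : Matrix (Fin m) (Fin m) ℝ)).PosSemidef ∧
  (((1 + ε) * (size A / m)) • (1 : Matrix (Fin m) (Fin m) ℝ) - leftMarginal A).PosSemidef ∧
  (rightMarginal A - ((1 - ε) * (size A / n)) • (1 : Matrix (Fin n) (Fin n) ℝ)).PosSemidef ∧
  (((1 + ε) * (size A / n)) • (1 : Matrix (Fin n) (Fin n) ℝ) - rightMarginal A).PosSemidef

/-- The `m² × n²` matrix `M_𝒜 = ∑ᵢ Aᵢ ⊗ Aᵢ`. -/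
noncomputable def naturalMatrix (A : Operator k m n) :
    Matrix (Fin m × Fin m) (Fin n × Fin n) ℝ :=
  ∑ i, A i ⊗ₖ A i

/-- `𝒜` has a `λ`-spectral gap: `σ₂(M_𝒜) ≤ (1 - λ) s(𝒜) / √(mn)`. Singular values are listed in
descending order with multiplicity and indexed from `0`, so that index `1` is the second largest. -/
def HasSpectralGap (lam : ℝ) (A : Operator k m n) : Prop :=
  (Matrix.toEuclideanLin (naturalMatrix A)).singularValues 1 ≤
    (1 - lam) * (size A / √((m : ℝ) * n))

/-- The left error matrix `E = s I - m ∑ᵢ Aᵢ Aᵢ*`. -/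
noncomputable def errorE (A : Operator k m n) : Matrix (Fin m) (Fin m) ℝ :=
  size A • (1 : Matrix (Fin m) (Fin m) ℝ) - (m : ℝ) • leftMarginal A

/-- The right error matrix `F = s I - n ∑ᵢ Aᵢ* Aᵢ`. -/
noncomputable def errorF (A : Operator k m n) : Matrix (Fin n) (Fin n) ℝ :=
  size A • (1 : Matrix (Fin n) (Fin n) ℝ) - (n : ℝ) • rightMarginal A

/-- One step of discrete gradient descent with step size `α`:
`Aᵢ ← (I + α E) Aᵢ (I + α F)`, where `E`, `F` are the error matrices of the current operator. -/
noncomputable def gradientStep (α : ℝ) (A : Operator k m n) : Operator k m n :=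
  fun i => (1 + α • errorE A) * A i * (1 + α • errorF A)

/-- The operator rescaled to size one (for nonzero size). -/
noncomputable def normalize (A : Operator k m n) : Operator k m n :=
  fun i => (√(size A))⁻¹ • A i

/-- The operator held by gradient descent with step size `α` after `t` iterations: it is started at
the input rescaled to size one. -/
noncomputable def gradientDescent (α : ℝ) (A : Operator k m n) (t : ℕ) : Operator k m n :=
  (gradientStep α)^[t] (normalize A)

/-- `B` is a scaling of `𝒜`: `Bᵢ = L Aᵢ R` for invertible scaling matrices `L`, `R`. -/
def IsScaling (A B : Operator k m n) : Prop :=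
  ∃ (L : Matrix (Fin m) (Fin m) ℝ) (R : Matrix (Fin n) (Fin n) ℝ),
    IsUnit L ∧ IsUnit R ∧ ∀ i, B i = L * A i * R

end OperatorScaling

/-! With `phi A Y = ∑ Aᵢ Y Aᵢ*`, one step changes the left error to `(1 - 2αs) E - 2α m·phi A F`
plus a multiple of the identity and a remainder of second order in the errors. The right error
behaves symmetrically. The trace of the new error vanishes, so the size also changes only to second
order.

Two norms are followed. In the weighted Frobenius norm `errorNorm`, the coupling of `E` and `F`
through `phi` has strength `κ`, the bound in `GapBound κ`. A step therefore multiplies the norm by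
`1 - 2α(s - κ) + 60αg`, where `g` bounds the operator norms of the errors
(`errorNorm_gradientStep_le`). The step raises `κ` by at most `60αg` (`gapBound_gradientStep`).
Decay at rate `αλ` thus persists as long as the accumulated sum of `αg` stays well below `λ`.

Bounding that sum by the Frobenius norm alone would cost a power of the dimension. Instead, to first
order each new operator norm is at most a convex combination of the two old ones
(`norm_errorE_gradientStep_le`), so `g` stays of order `ε` for `T ≈ log m / (αλ)` steps. By then
Frobenius decay has absorbed the factor `√m`, and `‖E‖` decays geometrically. `‖F‖` is not compared
with its Frobenius norm, which would cost `log n`; it is dragged down by `‖E‖` through the same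
recursion. The sum is of order `ε log m / λ`, which is small against `λ` exactly when `λ² ≥ C ε log
m`. This bootstrap is `linear_convergence`.

The initial bound `κ ≤ 1 - λ/2` comes from the second singular value by Ky Fan's inequality
(`gapBound_of_hasSpectralGap`). -/

open scoped Matrix Matrix.Norms.L2Operator

namespace OperatorScaling

/-! ### Frobenius and operator norms of real matrices. -/

section MatrixNorms

variable {m n p : ℕ}

/-- A matrix as a vector of Euclidean space. -/
noncomputable def vecL : Matrix (Fin m) (Fin n) ℝ →ₗ[ℝ] EuclideanSpace ℝ (Fin m × Fin n) where
  toFun X := WithLp.toLp 2 fun p => X p.1 p.2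
  map_add' _ _ := rfl
  map_smul' _ _ := rfl

lemma vecL_apply (X : Matrix (Fin m) (Fin n) ℝ) (q : Fin m × Fin n) : vecL X q = X q.1 q.2 := rfl

/-- The Frobenius norm. -/
noncomputable def fro : Seminorm ℝ (Matrix (Fin m) (Fin n) ℝ) :=
  (normSeminorm ℝ (EuclideanSpace ℝ (Fin m × Fin n))).comp vecL

/-- The Frobenius inner product. -/
noncomputable def fip (X Y : Matrix (Fin m) (Fin n) ℝ) : ℝ := inner ℝ (vecL X) (vecL Y)

lemma fro_eq_norm (X : Matrix (Fin m) (Fin n) ℝ) : fro X = ‖vecL X‖ := rfl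

lemma fro_sq (X : Matrix (Fin m) (Fin n) ℝ) : fro X ^ 2 = ∑ a, ∑ b, X a b ^ 2 := by
  rw [fro_eq_norm, EuclideanSpace.real_norm_sq_eq, Fintype.sum_prod_type]
  rfl

lemma fip_self (X : Matrix (Fin m) (Fin n) ℝ) : fip X X = fro X ^ 2 :=
  real_inner_self_eq_norm_sq _

lemma fip_eq_trace (X Y : Matrix (Fin m) (Fin n) ℝ) : fip X Y = (Xᵀ * Y).trace := by
  simp only [fip, vecL_apply, PiLp.inner_apply, Matrix.trace, Matrix.diag, Matrix.mul_apply, Matrix.transpose_apply, Fintype.sum_prod_type]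
  rw [Finset.sum_comm]
  simp [mul_comm]

lemma fip_comm (X Y : Matrix (Fin m) (Fin n) ℝ) : fip X Y = fip Y X := real_inner_comm _ _

lemma fip_add_right (X Y Z : Matrix (Fin m) (Fin n) ℝ) : fip X (Y + Z) = fip X Y + fip X Z := by
  simp [fip, inner_add_right]

lemma fip_sub_right (X Y Z : Matrix (Fin m) (Fin n) ℝ) : fip X (Y - Z) = fip X Y - fip X Z := by
  simp [fip, inner_sub_right]

lemma fip_sub_left (X Y Z : Matrix (Fin m) (Fin n) ℝ) : fip (X - Y) Z = fip X Z - fip Y Z := by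
  simp [fip, inner_sub_left]

lemma fip_smul_right (c : ℝ) (X Y : Matrix (Fin m) (Fin n) ℝ) : fip X (c • Y) = c * fip X Y := by
  simp [fip, inner_smul_right]

lemma abs_fip_le (X Y : Matrix (Fin m) (Fin n) ℝ) : |fip X Y| ≤ fro X * fro Y :=
  abs_real_inner_le_norm _ _

lemma fip_le (X Y : Matrix (Fin m) (Fin n) ℝ) : fip X Y ≤ fro X * fro Y :=
  real_inner_le_norm _ _

lemma fip_one_right (X : Matrix (Fin m) (Fin m) ℝ) : fip X 1 = X.trace := by
  simp [fip_eq_trace]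

lemma fro_nonneg (X : Matrix (Fin m) (Fin n) ℝ) : 0 ≤ fro X := apply_nonneg _ _

lemma fro_smul (c : ℝ) (X : Matrix (Fin m) (Fin n) ℝ) : fro (c • X) = |c| * fro X := by
  rw [map_smul_eq_mul, Real.norm_eq_abs]

lemma fro_transpose (X : Matrix (Fin m) (Fin n) ℝ) : fro Xᵀ = fro X := by
  rw [← sq_eq_sq₀ (fro_nonneg _) (fro_nonneg _), fro_sq, fro_sq, Finset.sum_comm]
  rfl

lemma opNorm_transpose (X : Matrix (Fin m) (Fin n) ℝ) : ‖Xᵀ‖ = ‖X‖ := by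
  rw [← Matrix.conjTranspose_eq_transpose_of_trivial, Matrix.l2_opNorm_conjTranspose]

lemma sum_sq_mulVec_le (X : Matrix (Fin m) (Fin n) ℝ) (v : Fin n → ℝ) :
    ∑ a, (X *ᵥ v) a ^ 2 ≤ ‖X‖ ^ 2 * ∑ b, v b ^ 2 := by
  have h := Matrix.l2_opNorm_mulVec X (WithLp.toLp 2 v)
  have h2 := pow_le_pow_left₀ (norm_nonneg _) h 2
  rw [mul_pow, EuclideanSpace.real_norm_sq_eq, EuclideanSpace.real_norm_sq_eq] at h2
  exact h2

lemma opNorm_le_of_sum_sq {X : Matrix (Fin m) (Fin n) ℝ} {c : ℝ} (hc : 0 ≤ c)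
    (h : ∀ v : Fin n → ℝ, ∑ a, (X *ᵥ v) a ^ 2 ≤ c ^ 2 * ∑ b, v b ^ 2) : ‖X‖ ≤ c := by
  rw [Matrix.l2_opNorm_def]
  refine ContinuousLinearMap.opNorm_le_bound _ hc fun v => ?_
  rw [← sq_le_sq₀ (norm_nonneg _) (by positivity), mul_pow, EuclideanSpace.real_norm_sq_eq,
    EuclideanSpace.real_norm_sq_eq]
  exact h v

lemma fro_mul_le (X : Matrix (Fin m) (Fin n) ℝ) (Y : Matrix (Fin n) (Fin p) ℝ) :
    fro (X * Y) ≤ ‖X‖ * fro Y := by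
  rw [← sq_le_sq₀ (fro_nonneg _) (mul_nonneg (norm_nonneg _) (fro_nonneg _)), mul_pow, fro_sq,
    fro_sq, Finset.sum_comm, Finset.sum_comm (f := fun a b => Y a b ^ 2), Finset.mul_sum]
  exact Finset.sum_le_sum fun b _ => sum_sq_mulVec_le X fun a => Y a b

lemma fro_mul_le' (X : Matrix (Fin m) (Fin n) ℝ) (Y : Matrix (Fin n) (Fin p) ℝ) :
    fro (X * Y) ≤ fro X * ‖Y‖ := by
  rw [← fro_transpose, Matrix.transpose_mul, mul_comm, ← opNorm_transpose Y, ← fro_transpose X]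
  exact fro_mul_le _ _

lemma opNorm_le_fro (X : Matrix (Fin m) (Fin n) ℝ) : ‖X‖ ≤ fro X := by
  refine opNorm_le_of_sum_sq (fro_nonneg _) fun v => ?_
  rw [fro_sq, Finset.sum_mul]
  exact Finset.sum_le_sum fun a _ =>
    Finset.sum_mul_sq_le_sq_mul_sq Finset.univ (X a) v

lemma opNorm_one_le : ‖(1 : Matrix (Fin m) (Fin m) ℝ)‖ ≤ 1 :=
  opNorm_le_of_sum_sq zero_le_one fun v => by simp

lemma abs_dotProduct_mulVec_le (X : Matrix (Fin m) (Fin n) ℝ) (u : Fin m → ℝ) (v : Fin n → ℝ) :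
    |u ⬝ᵥ X *ᵥ v| ≤ ‖X‖ * (√(∑ a, u a ^ 2) * √(∑ b, v b ^ 2)) := by
  have h1 : |u ⬝ᵥ X *ᵥ v| ≤ √(∑ a, u a ^ 2) * √(∑ a, (X *ᵥ v) a ^ 2) := by
    rw [← Real.sqrt_mul (by positivity)]
    exact Real.abs_le_sqrt (Finset.sum_mul_sq_le_sq_mul_sq _ _ _)
  have h2 : √(∑ a, (X *ᵥ v) a ^ 2) ≤ ‖X‖ * √(∑ b, v b ^ 2) := by
    rw [← Real.sqrt_sq (norm_nonneg X), ← Real.sqrt_mul (by positivity)]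
    exact Real.sqrt_le_sqrt (by simpa using sum_sq_mulVec_le X v)
  calc _ ≤ _ := h1
    _ ≤ √(∑ a, u a ^ 2) * (‖X‖ * √(∑ b, v b ^ 2)) := by gcongr
    _ = _ := by ring

lemma dotProduct_mulVec_self_le (X : Matrix (Fin m) (Fin m) ℝ) (v : Fin m → ℝ) :
    |v ⬝ᵥ X *ᵥ v| ≤ ‖X‖ * ∑ a, v a ^ 2 := by
  simpa [Real.mul_self_sqrt (Finset.sum_nonneg fun a _ => sq_nonneg (v a))] using
    abs_dotProduct_mulVec_le X v v

lemma abs_trace_le (X : Matrix (Fin m) (Fin m) ℝ) : |X.trace| ≤ m * ‖X‖ := by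
  have h : ∀ a, |X a a| ≤ ‖X‖ := fun a => by
    have := dotProduct_mulVec_self_le X (Pi.single a 1)
    simpa [Pi.single_apply] using this
  calc |X.trace| ≤ ∑ a, |X a a| := Finset.abs_sum_le_sum_abs _ _
    _ ≤ ∑ _a : Fin m, ‖X‖ := Finset.sum_le_sum fun a _ => h a
    _ = m * ‖X‖ := by simp

lemma opNorm_le_of_dotProduct {X : Matrix (Fin m) (Fin n) ℝ} {c : ℝ} (hc : 0 ≤ c)
    (h : ∀ u v, u ⬝ᵥ X *ᵥ v ≤ c * (√(∑ a, u a ^ 2) * √(∑ b, v b ^ 2))) : ‖X‖ ≤ c := by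
  refine opNorm_le_of_sum_sq hc fun v => ?_
  set S := ∑ a, (X *ᵥ v) a ^ 2
  have hS : 0 ≤ S := by positivity
  have h1 := h (X *ᵥ v) v
  have h2 : (X *ᵥ v) ⬝ᵥ X *ᵥ v = S := by simp [dotProduct, S, sq]
  rw [h2] at h1
  have hq := Real.sq_sqrt hS
  have hb : 0 ≤ ∑ b, v b ^ 2 := by positivity
  have hv := Real.sq_sqrt hb
  have h3 : √S ≤ c * √(∑ b, v b ^ 2) := by
    by_contra! hlt
    have hp : 0 < √S := lt_of_le_of_lt (by positivity) hlt
    nlinarith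
  calc S = √S ^ 2 := hq.symm
    _ ≤ (c * √(∑ b, v b ^ 2)) ^ 2 := by gcongr
    _ = _ := by rw [mul_pow, hv]

/-- Polarization turns the bound on the quadratic form of a symmetric matrix into one on its
bilinear form. Testing the latter at `X v` and `c v` bounds `‖X v‖`, with no recourse to
eigenvalues. -/
lemma opNorm_le_of_posSemidef {X : Matrix (Fin m) (Fin m) ℝ} {c : ℝ} (hc : 0 ≤ c)
    (hX : Xᵀ = X) (h1 : (c • (1 : Matrix (Fin m) (Fin m) ℝ) - X).PosSemidef)
    (h2 : (c • (1 : Matrix (Fin m) (Fin m) ℝ) + X).PosSemidef) : ‖X‖ ≤ c := by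
  have hq : ∀ v : Fin m → ℝ, |v ⬝ᵥ X *ᵥ v| ≤ c * (v ⬝ᵥ v) := fun v => by
    have a1 := h1.dotProduct_mulVec_nonneg v
    have a2 := h2.dotProduct_mulVec_nonneg v
    simp only [star_trivial, Matrix.sub_mulVec, Matrix.add_mulVec, Matrix.smul_mulVec,
      Matrix.one_mulVec, dotProduct_sub, dotProduct_add, dotProduct_smul, smul_eq_mul] at a1 a2
    rw [abs_le]
    constructor <;> linarith
  have hsymm : ∀ u v : Fin m → ℝ, v ⬝ᵥ X *ᵥ u = u ⬝ᵥ X *ᵥ v := fun u v => by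
    rw [Matrix.dotProduct_mulVec, ← Matrix.mulVec_transpose, hX, dotProduct_comm]
  have hpol : ∀ u v : Fin m → ℝ, 2 * (u ⬝ᵥ X *ᵥ v) ≤ c * (u ⬝ᵥ u + v ⬝ᵥ v) := fun u v => by
    have a1 := (abs_le.1 (hq (u + v))).2
    have a2 := (abs_le.1 (hq (u - v))).1
    simp only [Matrix.mulVec_add, Matrix.mulVec_sub, dotProduct_add, add_dotProduct,
      dotProduct_sub, sub_dotProduct] at a1 a2
    have := hsymm u v
    have := dotProduct_comm u v
    linarith
  refine opNorm_le_of_sum_sq hc fun v => ?_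
  have h := hpol (X *ᵥ v) (c • v)
  simp only [Matrix.mulVec_smul, dotProduct_smul, smul_dotProduct, smul_eq_mul] at h
  have e1 : ∑ a, (X *ᵥ v) a ^ 2 = (X *ᵥ v) ⬝ᵥ (X *ᵥ v) := by simp [dotProduct, sq]
  have e2 : ∑ a, v a ^ 2 = v ⬝ᵥ v := by simp [dotProduct, sq]
  rw [e1, e2]
  rcases hc.eq_or_lt with rfl | hc'
  · have h0 := hpol (X *ᵥ v) v
    simp only [zero_mul] at h0
    nlinarith
  · have : c * ((X *ᵥ v) ⬝ᵥ (X *ᵥ v)) ≤ c * (c ^ 2 * (v ⬝ᵥ v)) := by nlinarith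
    exact le_of_mul_le_mul_left this hc'

lemma posSemidef_of_opNorm_le {X : Matrix (Fin m) (Fin m) ℝ} {c : ℝ} (hX : Xᵀ = X)
    (h : ‖X‖ ≤ c) : (c • (1 : Matrix (Fin m) (Fin m) ℝ) - X).PosSemidef := by
  refine Matrix.PosSemidef.of_dotProduct_mulVec_nonneg ?_ fun v => ?_
  · rw [Matrix.IsHermitian, Matrix.conjTranspose_eq_transpose_of_trivial]
    simp [hX]
  · have a := (abs_le.1 (dotProduct_mulVec_self_le X v)).2
    simp only [star_trivial, Matrix.sub_mulVec, Matrix.smul_mulVec,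
      Matrix.one_mulVec, dotProduct_sub, dotProduct_smul, smul_eq_mul]
    have e2 : ∑ a, v a ^ 2 = v ⬝ᵥ v := by simp [dotProduct, sq]
    have h0 : 0 ≤ v ⬝ᵥ v := by rw [← e2]; positivity
    rw [e2] at a
    nlinarith

end MatrixNorms

end OperatorScaling

namespace OperatorScaling

/-! ### The completely positive map and the expansion of one gradient step. -/

section Step

variable {k m n : ℕ}

/-- The completely positive map `Y ↦ ∑ᵢ Aᵢ Y Aᵢ*`. -/
noncomputable def phi (A : Operator k m n) (Y : Matrix (Fin n) (Fin n) ℝ) :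
    Matrix (Fin m) (Fin m) ℝ := ∑ i, A i * Y * (A i)ᵀ

/-- The operator of the transposed matrices. -/
def flip (A : Operator k m n) : Operator k n m := fun i => (A i)ᵀ

lemma flip_flip (A : Operator k m n) : flip (flip A) = A := rfl

lemma leftMarginal_flip (A : Operator k m n) : leftMarginal (flip A) = rightMarginal A := rfl

lemma rightMarginal_flip (A : Operator k m n) : rightMarginal (flip A) = leftMarginal A := rfl

lemma size_flip (A : Operator k m n) : size (flip A) = size A :=
  Finset.sum_congr rfl fun _ _ => Finset.sum_comm

lemma errorE_flip (A : Operator k m n) : errorE (flip A) = errorF A := by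
  rw [errorE, errorF, size_flip, leftMarginal_flip]

lemma errorF_flip (A : Operator k m n) : errorF (flip A) = errorE A := by
  rw [errorE, errorF, size_flip, rightMarginal_flip]

lemma leftMarginal_transpose (A : Operator k m n) : (leftMarginal A)ᵀ = leftMarginal A := by
  simp [leftMarginal, Matrix.transpose_sum]

lemma rightMarginal_transpose (A : Operator k m n) : (rightMarginal A)ᵀ = rightMarginal A :=
  leftMarginal_transpose (flip A)

lemma errorE_transpose (A : Operator k m n) : (errorE A)ᵀ = errorE A := by
  simp [errorE, leftMarginal_transpose]

lemma errorF_transpose (A : Operator k m n) : (errorF A)ᵀ = errorF A := by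
  simp [errorF, rightMarginal_transpose]

/-- Transposition exchanges the two errors and commutes with the dynamics, so each estimate for `E`
yields the one for `F`. -/
lemma gradientStep_flip (α : ℝ) (A : Operator k m n) :
    gradientStep α (flip A) = flip (gradientStep α A) := by
  funext i
  simp [gradientStep, flip, ← errorE_flip (flip A), errorE_flip,
    Matrix.transpose_mul, errorE_transpose, errorF_transpose, Matrix.mul_assoc, flip_flip]

lemma trace_leftMarginal (A : Operator k m n) : (leftMarginal A).trace = size A := by
  simp only [leftMarginal, Matrix.trace_sum, size]
  refine Finset.sum_congr rfl fun i _ => ?_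
  simp [Matrix.trace, Matrix.mul_apply, sq]

lemma trace_errorE (A : Operator k m n) : (errorE A).trace = 0 := by
  simp [errorE, trace_leftMarginal, mul_comm]

lemma trace_errorF (A : Operator k m n) : (errorF A).trace = 0 := by
  rw [← errorE_flip, trace_errorE]

lemma fip_phi (A : Operator k m n) (X : Matrix (Fin m) (Fin m) ℝ) (Y : Matrix (Fin n) (Fin n) ℝ) :
    fip X (phi A Y) = ∑ i, fip (X * A i) (A i * Y) := by
  simp only [fip_eq_trace, phi, Matrix.mul_sum, Matrix.trace_sum]
  refine Finset.sum_congr rfl fun i _ => ?_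
  rw [Matrix.transpose_mul, ← Matrix.mul_assoc, Matrix.trace_mul_comm]
  simp only [Matrix.mul_assoc]

lemma sum_fro_mul_sq (A : Operator k m n) (X : Matrix (Fin m) (Fin m) ℝ) :
    ∑ i, fro (X * A i) ^ 2 = fip X (X * leftMarginal A) := by
  simp only [← fip_self, fip_eq_trace, leftMarginal, Matrix.mul_sum, Matrix.trace_sum]
  refine Finset.sum_congr rfl fun i _ => ?_
  rw [Matrix.transpose_mul, Matrix.mul_assoc, Matrix.trace_mul_comm]
  simp only [Matrix.mul_assoc]

lemma fro_mul_sq_sum_le (A : Operator k m n) (X : Matrix (Fin m) (Fin m) ℝ) :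
    ∑ i, fro (X * A i) ^ 2 ≤ ‖leftMarginal A‖ * fro X ^ 2 := by
  rw [sum_fro_mul_sq]
  have := fro_mul_le' X (leftMarginal A)
  nlinarith [fip_le X (X * leftMarginal A), fro_nonneg X]

lemma mul_fro_sq_sum_le (A : Operator k m n) (Y : Matrix (Fin n) (Fin n) ℝ) :
    ∑ i, fro (A i * Y) ^ 2 ≤ ‖rightMarginal A‖ * fro Y ^ 2 := by
  have h := fro_mul_sq_sum_le (flip A) Yᵀ
  rw [leftMarginal_flip] at h
  simpa only [flip, ← Matrix.transpose_mul, fro_transpose] using h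

/-- One factor `Aᵢ` goes to `X` and the other to `Y`; Cauchy–Schwarz over `i` then gives the
geometric mean of the two marginal norms, which has the natural scale `1/√(mn)`. -/
lemma abs_fip_phi_le (A : Operator k m n) (X : Matrix (Fin m) (Fin m) ℝ)
    (Y : Matrix (Fin n) (Fin n) ℝ) :
    |fip X (phi A Y)| ≤ √‖leftMarginal A‖ * √‖rightMarginal A‖ * (fro X * fro Y) := by
  rw [fip_phi]
  calc |∑ i, fip (X * A i) (A i * Y)| ≤ ∑ i, |fip (X * A i) (A i * Y)| :=
        Finset.abs_sum_le_sum_abs _ _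
    _ ≤ ∑ i, fro (X * A i) * fro (A i * Y) := Finset.sum_le_sum fun i _ => abs_fip_le _ _
    _ ≤ √(∑ i, fro (X * A i) ^ 2) * √(∑ i, fro (A i * Y) ^ 2) :=
        Real.sum_mul_le_sqrt_mul_sqrt _ _ _
    _ ≤ √(‖leftMarginal A‖ * fro X ^ 2) * √(‖rightMarginal A‖ * fro Y ^ 2) := by
        gcongr
        · exact fro_mul_sq_sum_le A X
        · exact mul_fro_sq_sum_le A Y
    _ = _ := by
        rw [Real.sqrt_mul (norm_nonneg _), Real.sqrt_mul (norm_nonneg _),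
          Real.sqrt_sq (fro_nonneg _), Real.sqrt_sq (fro_nonneg _)]
        ring

lemma fro_phi_le (A : Operator k m n) (Y : Matrix (Fin n) (Fin n) ℝ) :
    fro (phi A Y) ≤ √‖leftMarginal A‖ * √‖rightMarginal A‖ * fro Y := by
  have h := (le_abs_self _).trans (abs_fip_phi_le A (phi A Y) Y)
  rw [fip_self] at h
  have hY := fro_nonneg Y
  rcases (fro_nonneg (phi A Y)).eq_or_lt with h0 | h0
  · rw [← h0]; positivity
  · refine le_of_mul_le_mul_left ?_ h0
    linarith

/-- Cauchy–Schwarz applied to the vectors `Aᵢ* u` and `Aᵢ* v`. Only the left marginal enters, so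
after multiplication by `m` the constant is the size up to the error, with no dimensional factor. -/
lemma opNorm_phi_le (A : Operator k m n) (Y : Matrix (Fin n) (Fin n) ℝ) :
    ‖phi A Y‖ ≤ ‖Y‖ * ‖leftMarginal A‖ := by
  refine opNorm_le_of_dotProduct (by positivity) fun u v => ?_
  have hP : ∀ w : Fin m → ℝ, ∑ i, ∑ b, ((A i)ᵀ *ᵥ w) b ^ 2 ≤ ‖leftMarginal A‖ * ∑ a, w a ^ 2 := by
    intro w
    refine le_trans (le_of_eq ?_) ((le_abs_self _).trans (dotProduct_mulVec_self_le _ w))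
    rw [leftMarginal, Matrix.sum_mulVec, dotProduct_sum]
    refine Finset.sum_congr rfl fun i _ => ?_
    rw [← Matrix.mulVec_mulVec, Matrix.dotProduct_mulVec, ← Matrix.mulVec_transpose]
    simp [dotProduct, sq]
  have hP' : ∀ w : Fin m → ℝ, √(∑ i, √(∑ b, ((A i)ᵀ *ᵥ w) b ^ 2) ^ 2) ≤
      √‖leftMarginal A‖ * √(∑ a, w a ^ 2) := by
    intro w
    rw [← Real.sqrt_mul (norm_nonneg _)]
    refine Real.sqrt_le_sqrt (le_trans (le_of_eq ?_) (hP w))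
    exact Finset.sum_congr rfl fun i _ => Real.sq_sqrt (by positivity)
  calc u ⬝ᵥ phi A Y *ᵥ v = ∑ i, ((A i)ᵀ *ᵥ u) ⬝ᵥ Y *ᵥ ((A i)ᵀ *ᵥ v) := by
        rw [phi, Matrix.sum_mulVec, dotProduct_sum]
        refine Finset.sum_congr rfl fun i _ => ?_
        rw [← Matrix.mulVec_mulVec, ← Matrix.mulVec_mulVec, Matrix.dotProduct_mulVec,
          ← Matrix.mulVec_transpose]
    _ ≤ ∑ i, ‖Y‖ * (√(∑ b, ((A i)ᵀ *ᵥ u) b ^ 2) * √(∑ b, ((A i)ᵀ *ᵥ v) b ^ 2)) :=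
        Finset.sum_le_sum fun i _ => (le_abs_self _).trans (abs_dotProduct_mulVec_le _ _ _)
    _ ≤ ‖Y‖ * ((√‖leftMarginal A‖ * √(∑ a, u a ^ 2)) * (√‖leftMarginal A‖ * √(∑ a, v a ^ 2))) := by
        rw [← Finset.mul_sum]
        gcongr
        exact (Real.sum_mul_le_sqrt_mul_sqrt _ _ _).trans
          (mul_le_mul (hP' u) (hP' v) (by positivity) (by positivity))
    _ = _ := by
        have := Real.mul_self_sqrt (norm_nonneg (leftMarginal A))
        linear_combination ‖Y‖ * √(∑ a, u a ^ 2) * √(∑ a, v a ^ 2) * this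

lemma fip_phi_flip (A : Operator k m n) (X : Matrix (Fin m) (Fin m) ℝ)
    (Y : Matrix (Fin n) (Fin n) ℝ) : fip Y (phi (flip A) X) = fip X (phi A Y) := by
  rw [fip_comm X]
  simp only [fip_eq_trace, phi, flip, Matrix.mul_sum, Matrix.transpose_sum, Matrix.sum_mul,
    Matrix.trace_sum]
  refine Finset.sum_congr rfl fun i _ => ?_
  simp only [Matrix.transpose_mul, Matrix.transpose_transpose]
  rw [← Matrix.mul_assoc, Matrix.trace_mul_comm]
  simp only [Matrix.mul_assoc]

lemma trace_phi (A : Operator k m n) (Y : Matrix (Fin n) (Fin n) ℝ) :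
    (phi A Y).trace = (rightMarginal A * Y).trace := by
  simp only [phi, rightMarginal, Matrix.trace_sum, Matrix.sum_mul]
  refine Finset.sum_congr rfl fun i _ => ?_
  rw [Matrix.trace_mul_comm, ← Matrix.mul_assoc]

lemma smul_leftMarginal (A : Operator k m n) :
    (m : ℝ) • leftMarginal A = size A • 1 - errorE A := by
  simp [errorE]

lemma smul_rightMarginal (A : Operator k m n) :
    (n : ℝ) • rightMarginal A = size A • 1 - errorF A := by
  simp [errorF]

lemma phi_gradientStep (α : ℝ) (A : Operator k m n) (Y : Matrix (Fin n) (Fin n) ℝ) :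
    phi (gradientStep α A) Y =
      (1 + α • errorE A) * phi A ((1 + α • errorF A) * Y * (1 + α • errorF A)) *
        (1 + α • errorE A) := by
  simp only [phi, Matrix.mul_sum, Matrix.sum_mul]
  refine Finset.sum_congr rfl fun i _ => ?_
  simp only [gradientStep, Matrix.transpose_mul, Matrix.transpose_add, Matrix.transpose_one,
    Matrix.transpose_smul, errorE_transpose, errorF_transpose, Matrix.mul_assoc]

lemma phi_add (A : Operator k m n) (X Y : Matrix (Fin n) (Fin n) ℝ) :
    phi A (X + Y) = phi A X + phi A Y := by
  simp [phi, Matrix.mul_add, Matrix.add_mul, Finset.sum_add_distrib]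

lemma phi_smul (A : Operator k m n) (c : ℝ) (Y : Matrix (Fin n) (Fin n) ℝ) :
    phi A (c • Y) = c • phi A Y := by
  simp [phi, Finset.smul_sum]

lemma phi_one (A : Operator k m n) : phi A 1 = leftMarginal A := by
  simp [phi, leftMarginal]

/-- The part of the left error of a gradient step that is of second order in the errors. -/
noncomputable def stepRemainder (α s : ℝ) (E U V : Matrix (Fin m) (Fin m) ℝ) :
    Matrix (Fin m) (Fin m) ℝ :=
  (2 * α - α ^ 2 * s) • (E * E) + α ^ 2 • (E * E * E) - α ^ 2 • V
    - (2 * α ^ 2) • (E * U + U * E) - (2 * α ^ 3) • (E * U * E) - α ^ 3 • (E * V + V * E)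
    - α ^ 4 • (E * V * E)

/-- The left side keeps the old size; the change of size is restored separately as a multiple of the
identity in `errorE_gradientStep`. -/
lemma leftMarginal_gradientStep (α : ℝ) (A : Operator k m n) :
    size A • (1 : Matrix (Fin m) (Fin m) ℝ) - (m : ℝ) • leftMarginal (gradientStep α A) =
      (1 - 2 * α * size A) • errorE A - (2 * α) • ((m : ℝ) • phi A (errorF A)) +
        stepRemainder α (size A) (errorE A) ((m : ℝ) • phi A (errorF A))
          ((m : ℝ) • phi A (errorF A * errorF A)) := by
  have h : (m : ℝ) • leftMarginal (gradientStep α A) = (1 + α • errorE A) *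
      ((size A • 1 - errorE A) + (2 * α) • ((m : ℝ) • phi A (errorF A)) +
        α ^ 2 • ((m : ℝ) • phi A (errorF A * errorF A))) * (1 + α • errorE A) := by
    rw [← phi_one, phi_gradientStep, ← Matrix.smul_mul, ← Matrix.mul_smul]
    congr 2
    have : (1 + α • errorF A) * 1 * (1 + α • errorF A) =
        1 + (2 * α) • errorF A + α ^ 2 • (errorF A * errorF A) := by
      simp only [mul_one, mul_add, add_mul, one_mul, smul_mul_assoc, mul_smul_comm]
      module
    rw [this, phi_add, phi_add, phi_smul, phi_smul, phi_one, smul_add, smul_add,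
      smul_leftMarginal]
    module
  rw [h, stepRemainder]
  generalize (m : ℝ) • phi A (errorF A) = U
  generalize (m : ℝ) • phi A (errorF A * errorF A) = V
  simp only [mul_one, mul_add, add_mul, one_mul, mul_sub, sub_mul, smul_mul_assoc,
    mul_smul_comm, smul_add, smul_sub, mul_assoc]
  module

/-- Every term of the remainder carries a factor `α` and two errors: one is measured in operator
norm by `g`, the other in `ν` by `φ`. A general `ν` serves both the operator and the Frobenius norm.
-/
lemma stepRemainder_le (ν : Seminorm ℝ (Matrix (Fin m) (Fin m) ℝ))
    (hl : ∀ X Y, ν (X * Y) ≤ ‖X‖ * ν Y) (hr : ∀ X Y, ν (X * Y) ≤ ν X * ‖Y‖)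
    {α s g φ : ℝ} {E U V : Matrix (Fin m) (Fin m) ℝ} (hα : 0 ≤ α) (hα1 : α ≤ 1) (hs : 0 ≤ s)
    (hs2 : s ≤ 2) (hg1 : g ≤ 1) (hE : ‖E‖ ≤ g) (hνE : ν E ≤ φ) (hνU : ν U ≤ 2 * φ)
    (hνV : ν V ≤ 2 * g * φ) : ν (stepRemainder α s E U V) ≤ 25 * α * g * φ := by
  have hg : 0 ≤ g := (norm_nonneg _).trans hE
  have hφ : 0 ≤ φ := (apply_nonneg _ _).trans hνE
  have key : ∀ {X : Matrix (Fin m) (Fin m) ℝ} {x : ℝ}, ν X ≤ x → ν (E * X) ≤ g * x ∧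
      ν (X * E) ≤ g * x := fun {X x} hx =>
    ⟨(hl _ _).trans (mul_le_mul hE hx (apply_nonneg _ _) hg),
      (hr _ _).trans ((mul_le_mul hx hE (norm_nonneg _) ((apply_nonneg _ _).trans hx)).trans
        (mul_comm _ _).le)⟩
  have gφ : 0 ≤ g * φ := by positivity
  have ggφ : g * (g * φ) ≤ g * φ := by nlinarith
  have gggφ : g * (g * (g * φ)) ≤ g * φ := by nlinarith
  have ggggφ : g * (g * (g * (g * φ))) ≤ g * φ := by nlinarith
  have smul_le : ∀ {X : Matrix (Fin m) (Fin m) ℝ} {x c C : ℝ}, ν X ≤ x → |c| ≤ C →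
      ν (c • X) ≤ C * x := fun {X x c C} hx hc => by
    rw [map_smul_eq_mul, Real.norm_eq_abs]
    exact mul_le_mul hc hx (apply_nonneg _ _) ((abs_nonneg _).trans hc)
  have a2 : α ^ 2 ≤ α := by nlinarith
  have a3 : α ^ 3 ≤ α := by nlinarith [sq_nonneg α]
  have a4 : α ^ 4 ≤ α := by nlinarith [sq_nonneg α, sq_nonneg (α ^ 2)]
  have p2 : 0 ≤ α ^ 2 := by positivity
  have p3 : 0 ≤ α ^ 3 := by positivity
  have p4 : 0 ≤ α ^ 4 := by positivity
  have t1 : ν ((2 * α - α ^ 2 * s) • (E * E)) ≤ (2 * α) * (g * φ) :=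
    smul_le (key hνE).1 (abs_le.2 ⟨by nlinarith, by nlinarith⟩)
  have t2 : ν (α ^ 2 • (E * E * E)) ≤ α * (g * φ) :=
    smul_le ((key (key hνE).1).2.trans ggφ) (by rwa [abs_of_nonneg p2])
  have t3 : ν (α ^ 2 • V) ≤ α * (2 * g * φ) := smul_le hνV (by rwa [abs_of_nonneg p2])
  have t4 : ν ((2 * α ^ 2) • (E * U + U * E)) ≤ (2 * α) * (g * (2 * φ) + g * (2 * φ)) :=
    smul_le ((map_add_le_add _ _ _).trans (add_le_add (key hνU).1 (key hνU).2))
      (by rw [abs_of_nonneg (by positivity)]; linarith)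
  have t5 : ν ((2 * α ^ 3) • (E * U * E)) ≤ (2 * α) * (g * (g * (2 * φ))) :=
    smul_le (key (key hνU).1).2 (by rw [abs_of_nonneg (by positivity)]; linarith)
  have t6 : ν (α ^ 3 • (E * V + V * E)) ≤ α * (g * (2 * g * φ) + g * (2 * g * φ)) :=
    smul_le ((map_add_le_add _ _ _).trans (add_le_add (key hνV).1 (key hνV).2))
      (by rwa [abs_of_nonneg p3])
  have t7 : ν (α ^ 4 • (E * V * E)) ≤ α * (g * (g * (2 * g * φ))) :=
    smul_le (key (key hνV).1).2 (by rwa [abs_of_nonneg p4])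
  have sub_le : ∀ {X Y : Matrix (Fin m) (Fin m) ℝ} {x y : ℝ}, ν X ≤ x → ν Y ≤ y →
      ν (X - Y) ≤ x + y := fun hx hy => (map_sub_le_add _ _ _).trans (add_le_add hx hy)
  have := sub_le (sub_le (sub_le (sub_le (sub_le ((map_add_le_add ν _ _).trans
    (add_le_add t1 t2)) t3) t4) t5) t6) t7
  refine this.trans ?_
  have e : ∀ x y : ℝ, x ≤ y → α * x ≤ α * y := fun x y h => mul_le_mul_of_nonneg_left h hα
  have := e _ _ ggφ
  have := e _ _ gggφ
  have : 0 ≤ α * (g * φ) := by positivity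
  nlinarith

end Step

end OperatorScaling

namespace OperatorScaling

/-! ### Estimates for a single gradient step. -/

section OneStep

variable {k m n : ℕ}

lemma opNorm_leftMarginal_le (A : Operator k m n) {g : ℝ} (hE : ‖errorE A‖ ≤ g) :
    m * ‖leftMarginal A‖ ≤ size A + g := by
  have hs : 0 ≤ size A := by unfold size; positivity
  calc m * ‖leftMarginal A‖ = ‖(m : ℝ) • leftMarginal A‖ := by simp [norm_smul]
    _ ≤ ‖size A • (1 : Matrix (Fin m) (Fin m) ℝ)‖ + ‖errorE A‖ := by
        rw [smul_leftMarginal]; exact norm_sub_le _ _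
    _ ≤ size A * 1 + g := by
        rw [norm_smul, Real.norm_of_nonneg hs]
        gcongr
        exact opNorm_one_le
    _ = _ := by ring

lemma opNorm_rightMarginal_le (A : Operator k m n) {g : ℝ} (hF : ‖errorF A‖ ≤ g) :
    n * ‖rightMarginal A‖ ≤ size A + g := by
  rw [← leftMarginal_flip, ← size_flip]
  exact opNorm_leftMarginal_le (flip A) (by rwa [errorE_flip])

lemma sqrt_opNorm_marginals_le (A : Operator k m n) (hm : 0 < m) (hn : 0 < n)
    (hP : m * ‖leftMarginal A‖ ≤ 2) (hQ : n * ‖rightMarginal A‖ ≤ 2) :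
    √‖leftMarginal A‖ * √‖rightMarginal A‖ ≤ 2 / (√m * √n) := by
  have hm' : 0 < √(m : ℝ) := by positivity
  have hn' : 0 < √(n : ℝ) := by positivity
  have h1 : √(m : ℝ) * √‖leftMarginal A‖ ≤ √2 := by
    rw [← Real.sqrt_mul (Nat.cast_nonneg _)]; exact Real.sqrt_le_sqrt hP
  have h2 : √(n : ℝ) * √‖rightMarginal A‖ ≤ √2 := by
    rw [← Real.sqrt_mul (Nat.cast_nonneg _)]; exact Real.sqrt_le_sqrt hQ
  rw [le_div_iff₀ (by positivity)]
  calc _ = (√(m : ℝ) * √‖leftMarginal A‖) * (√(n : ℝ) * √‖rightMarginal A‖) := by ring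
    _ ≤ √2 * √2 := mul_le_mul h1 h2 (by positivity) (by positivity)
    _ = 2 := Real.mul_self_sqrt (by norm_num)

/-- The weighted Frobenius norm of the pair of error matrices. -/
noncomputable def errorNorm (A : Operator k m n) : ℝ :=
  √((fro (errorE A) / √m) ^ 2 + (fro (errorF A) / √n) ^ 2)

lemma errorNorm_nonneg (A : Operator k m n) : 0 ≤ errorNorm A := Real.sqrt_nonneg _

lemma errorNorm_sq (A : Operator k m n) :
    errorNorm A ^ 2 = (fro (errorE A) / √m) ^ 2 + (fro (errorF A) / √n) ^ 2 :=
  Real.sq_sqrt (by positivity)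

lemma errorNorm_flip (A : Operator k m n) : errorNorm (flip A) = errorNorm A := by
  rw [errorNorm, errorNorm, errorE_flip, errorF_flip, add_comm]

lemma fro_errorE_le (A : Operator k m n) (hm : 0 < m) : fro (errorE A) ≤ √m * errorNorm A := by
  have hm' : 0 < √(m : ℝ) := by positivity
  rw [mul_comm, ← div_le_iff₀ hm']
  exact Real.le_sqrt_of_sq_le (by nlinarith [sq_nonneg (fro (errorF A) / √n)])

lemma fro_errorF_le (A : Operator k m n) (hn : 0 < n) : fro (errorF A) ≤ √n * errorNorm A := by
  rw [← errorE_flip, ← errorNorm_flip]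
  exact fro_errorE_le _ hn

/-- Quantitative assumptions under which one gradient step is analysed. -/
structure IsControlled (α g : ℝ) (A : Operator k m n) : Prop where
  step_nonneg : 0 ≤ α
  step_le : α ≤ 1 / 8
  dim_left : 0 < m
  dim_right : 0 < n
  le_size : 3 / 4 ≤ size A
  size_le : size A ≤ 5 / 4
  g_le : g ≤ 1 / 4
  normE : ‖errorE A‖ ≤ g
  normF : ‖errorF A‖ ≤ g

namespace IsControlled

variable {α g : ℝ} {A : Operator k m n}

lemma flip (h : IsControlled α g A) : IsControlled α g (flip A) where
  step_nonneg := h.step_nonneg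
  step_le := h.step_le
  dim_left := h.dim_right
  dim_right := h.dim_left
  le_size := by rw [size_flip]; exact h.le_size
  size_le := by rw [size_flip]; exact h.size_le
  g_le := h.g_le
  normE := by rw [errorE_flip]; exact h.normF
  normF := by rw [errorF_flip]; exact h.normE

lemma g_nonneg (h : IsControlled α g A) : 0 ≤ g := (norm_nonneg _).trans h.normE

lemma opNorm_leftMarginal (h : IsControlled α g A) : m * ‖leftMarginal A‖ ≤ 2 :=
  (opNorm_leftMarginal_le A h.normE).trans (by linarith [h.size_le, h.g_le])

lemma opNorm_rightMarginal (h : IsControlled α g A) : n * ‖rightMarginal A‖ ≤ 2 :=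
  (opNorm_rightMarginal_le A h.normF).trans (by linarith [h.size_le, h.g_le])

lemma sqrt_marginals (h : IsControlled α g A) :
    √‖leftMarginal A‖ * √‖rightMarginal A‖ ≤ 2 / (√m * √n) :=
  sqrt_opNorm_marginals_le A h.dim_left h.dim_right h.opNorm_leftMarginal h.opNorm_rightMarginal

lemma norm_smul_phi_le (h : IsControlled α g A) (Y : Matrix (Fin n) (Fin n) ℝ) :
    ‖(m : ℝ) • phi A Y‖ ≤ ‖Y‖ * (size A + g) := by
  rw [norm_smul, Real.norm_natCast]
  nlinarith [opNorm_phi_le A Y, opNorm_leftMarginal_le A h.normE, norm_nonneg Y,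
    (Nat.cast_nonneg m : (0 : ℝ) ≤ m)]

lemma fro_smul_phi_le (h : IsControlled α g A) (Y : Matrix (Fin n) (Fin n) ℝ) :
    fro ((m : ℝ) • phi A Y) ≤ 2 * (√m * (fro Y / √n)) := by
  have hm' : 0 < √(m : ℝ) := Real.sqrt_pos.2 (Nat.cast_pos.2 h.dim_left)
  have hn' : 0 < √(n : ℝ) := Real.sqrt_pos.2 (Nat.cast_pos.2 h.dim_right)
  rw [fro_smul, abs_of_nonneg (Nat.cast_nonneg m)]
  have h1 := (fro_phi_le A Y).trans (mul_le_mul_of_nonneg_right h.sqrt_marginals (fro_nonneg Y))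
  calc (m : ℝ) * fro (phi A Y) ≤ m * (2 / (√m * √n) * fro Y) := by gcongr
    _ = 2 * (√m * (fro Y / √n)) := by
      nth_rewrite 1 [← Real.mul_self_sqrt (Nat.cast_nonneg m : (0 : ℝ) ≤ m)]
      field_simp

/-- The second order part of the left error of a gradient step. -/
noncomputable def remainder (α : ℝ) (A : Operator k m n) : Matrix (Fin m) (Fin m) ℝ :=
  stepRemainder α (size A) (errorE A) ((m : ℝ) • phi A (errorF A))
    ((m : ℝ) • phi A (errorF A * errorF A))

lemma norm_remainder_le (h : IsControlled α g A) : ‖remainder α A‖ ≤ 25 * α * g * g := by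
  have hg := h.g_nonneg
  have hg4 := h.g_le
  have hs := h.size_le
  have hFF : ‖errorF A * errorF A‖ ≤ g * g :=
    (norm_mul_le _ _).trans (mul_le_mul h.normF h.normF (norm_nonneg _) hg)
  refine stepRemainder_le (normSeminorm ℝ (Matrix (Fin m) (Fin m) ℝ)) (fun X Y => norm_mul_le X Y)
    (fun X Y => norm_mul_le X Y) h.step_nonneg (by linarith [h.step_le]) (by linarith [h.le_size])
    (by linarith) (by linarith) h.normE h.normE ?_ ?_
  · refine (h.norm_smul_phi_le _).trans ?_
    nlinarith [h.normF, norm_nonneg (errorF A)]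
  · refine (h.norm_smul_phi_le _).trans ?_
    nlinarith [norm_nonneg (errorF A * errorF A)]

lemma fro_remainder_le (h : IsControlled α g A) :
    fro (remainder α A) ≤ 25 * α * g * (√m * errorNorm A) := by
  have hg := h.g_nonneg
  have hg4 := h.g_le
  have hs := h.size_le
  have hn' : 0 < √(n : ℝ) := Real.sqrt_pos.2 (Nat.cast_pos.2 h.dim_right)
  have hF : fro (errorF A) / √n ≤ errorNorm A := by
    rw [div_le_iff₀ hn', mul_comm]; exact fro_errorF_le A h.dim_right
  refine stepRemainder_le fro fro_mul_le fro_mul_le' h.step_nonneg (by linarith [h.step_le])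
    (by linarith [h.le_size]) (by linarith) (by linarith) h.normE
    (fro_errorE_le A h.dim_left) ?_ ?_
  · exact (h.fro_smul_phi_le _).trans (by gcongr)
  · refine (h.fro_smul_phi_le _).trans ?_
    have h1 : fro (errorF A * errorF A) ≤ g * fro (errorF A) :=
      (fro_mul_le _ _).trans (mul_le_mul_of_nonneg_right h.normF (fro_nonneg _))
    calc 2 * (√m * (fro (errorF A * errorF A) / √n)) ≤ 2 * (√m * (g * fro (errorF A) / √n)) := by
          gcongr
      _ = 2 * g * (√m * (fro (errorF A) / √n)) := by ring
      _ ≤ _ := by gcongr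

lemma errorE_gradientStep (α : ℝ) (A : Operator k m n) :
    errorE (gradientStep α A) = (size (gradientStep α A) - size A) • 1 +
      ((1 - 2 * α * size A) • errorE A - (2 * α) • ((m : ℝ) • phi A (errorF A)) +
        remainder α A) := by
  rw [remainder, ← leftMarginal_gradientStep, errorE]
  module

/-- The trace equals that of `rightMarginal A * F`, and `n` times the right marginal is `s I - F`.
Since `F` is traceless, only `-F²` survives, so the apparent first-order term is quadratic. -/
lemma abs_trace_phi_errorF_le (h : IsControlled α g A) : |(phi A (errorF A)).trace| ≤ g ^ 2 := by
  have hn : (0 : ℝ) < n := Nat.cast_pos.2 h.dim_right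
  have h1 : (n : ℝ) * (phi A (errorF A)).trace = - (errorF A * errorF A).trace := by
    rw [trace_phi, ← smul_eq_mul, ← Matrix.trace_smul, ← Matrix.smul_mul, smul_rightMarginal,
      sub_mul, Matrix.trace_sub, smul_mul_assoc, one_mul, Matrix.trace_smul, trace_errorF]
    simp
  have h2 : |(errorF A * errorF A).trace| ≤ n * g ^ 2 := by
    refine (abs_trace_le _).trans ?_
    gcongr
    rw [sq]
    exact (norm_mul_le _ _).trans (mul_le_mul h.normF h.normF (norm_nonneg _) h.g_nonneg)
  have h3 : (n : ℝ) * |(phi A (errorF A)).trace| ≤ n * g ^ 2 := by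
    rw [← abs_of_pos hn, ← abs_mul, h1, abs_neg, abs_of_pos hn]; exact h2
  exact le_of_mul_le_mul_left h3 hn

/-- The new error is traceless, so taking traces in its expansion solves for the change of size: `2`
comes from the trace of `phi A F` and `25` from the remainder. -/
lemma abs_size_gradientStep_sub_le (h : IsControlled α g A) :
    |size (gradientStep α A) - size A| ≤ 27 * α * g ^ 2 := by
  have hm : (0 : ℝ) < m := Nat.cast_pos.2 h.dim_left
  have ht := congrArg Matrix.trace (errorE_gradientStep α A)
  simp only [trace_errorE, Matrix.trace_add, Matrix.trace_sub, Matrix.trace_smul, smul_eq_mul,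
    mul_zero, Matrix.trace_one, Fintype.card_fin] at ht
  have h1 := abs_le.1 h.abs_trace_phi_errorF_le
  have h2 := abs_le.1 ((abs_trace_le (remainder α A)).trans
    (mul_le_mul_of_nonneg_left h.norm_remainder_le hm.le))
  have hα := h.step_nonneg
  have hα1 : α * (phi A (errorF A)).trace ≤ α * g ^ 2 := mul_le_mul_of_nonneg_left h1.2 hα
  have hα2 : α * -g ^ 2 ≤ α * (phi A (errorF A)).trace := mul_le_mul_of_nonneg_left h1.1 hα
  have e : (size (gradientStep α A) - size A) * m =
      m * (2 * (α * (phi A (errorF A)).trace)) - (remainder α A).trace := by linear_combination -ht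
  have b1 := mul_le_mul_of_nonneg_left hα1 hm.le
  have b2 := mul_le_mul_of_nonneg_left hα2 hm.le
  rw [abs_le]
  constructor
  · refine le_of_mul_le_mul_right ?_ hm
    rw [e]; nlinarith [h2.2]
  · refine le_of_mul_le_mul_right ?_ hm
    rw [e]; nlinarith [h2.1]

/-- The two linear coefficients sum to one, so to first order the larger error norm does not grow.
The quadratic constant collects `27` from the size, `25` from the remainder and `2` from the bound
on `phi`. -/
lemma norm_errorE_gradientStep_le (h : IsControlled α g A) :
    ‖errorE (gradientStep α A)‖ ≤ (1 - 2 * α * size A) * ‖errorE A‖ +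
      2 * α * size A * ‖errorF A‖ + 60 * α * g ^ 2 := by
  have hg := h.g_nonneg
  have hα := h.step_nonneg
  have hc : 0 ≤ 1 - 2 * α * size A := by nlinarith [h.step_le, h.size_le, h.le_size]
  rw [errorE_gradientStep]
  have a1 : ‖(size (gradientStep α A) - size A) • (1 : Matrix (Fin m) (Fin m) ℝ)‖ ≤
      27 * α * g ^ 2 := by
    rw [norm_smul, Real.norm_eq_abs]
    nlinarith [h.abs_size_gradientStep_sub_le, opNorm_one_le (m := m),
      abs_nonneg (size (gradientStep α A) - size A)]
  have a2 : ‖(1 - 2 * α * size A) • errorE A‖ = (1 - 2 * α * size A) * ‖errorE A‖ := by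
    rw [norm_smul, Real.norm_of_nonneg hc]
  have a3 : ‖(2 * α) • ((m : ℝ) • phi A (errorF A))‖ ≤ 2 * α * (‖errorF A‖ * (size A + g)) := by
    rw [norm_smul, Real.norm_of_nonneg (by positivity)]
    gcongr
    exact h.norm_smul_phi_le _
  have a4 := h.norm_remainder_le
  have b1 := norm_add_le ((size (gradientStep α A) - size A) • (1 : Matrix (Fin m) (Fin m) ℝ))
    ((1 - 2 * α * size A) • errorE A - (2 * α) • ((m : ℝ) • phi A (errorF A)) + remainder α A)
  have b2 := norm_add_le
    ((1 - 2 * α * size A) • errorE A - (2 * α) • ((m : ℝ) • phi A (errorF A))) (remainder α A)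
  have b3 := norm_sub_le ((1 - 2 * α * size A) • errorE A)
    ((2 * α) • ((m : ℝ) • phi A (errorF A)))
  have c1 : α * (‖errorF A‖ * g) ≤ α * (g * g) := by gcongr; exact h.normF
  have c2 : 0 ≤ α * g ^ 2 := by positivity
  nlinarith

lemma norm_errorF_gradientStep_le (h : IsControlled α g A) :
    ‖errorF (gradientStep α A)‖ ≤ (1 - 2 * α * size A) * ‖errorF A‖ +
      2 * α * size A * ‖errorE A‖ + 60 * α * g ^ 2 := by
  have := h.flip.norm_errorE_gradientStep_le
  rwa [gradientStep_flip, errorE_flip, errorE_flip, errorF_flip, size_flip] at this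

/-- Pairing the expansion with the new error itself, which is traceless, removes the multiple of the
identity that records the change of size. -/
lemma fro_errorE_gradientStep_sq_le (h : IsControlled α g A) :
    fro (errorE (gradientStep α A)) ^ 2 ≤
      (1 - 2 * α * size A) * (fro (errorE (gradientStep α A)) * fro (errorE A)) +
      2 * α * (m * |fip (errorE (gradientStep α A)) (phi A (errorF A))|) +
      25 * α * g * (√m * errorNorm A) * fro (errorE (gradientStep α A)) := by
  set E' := errorE (gradientStep α A) with hE'
  have hα := h.step_nonneg
  have hc : 0 ≤ 1 - 2 * α * size A := by nlinarith [h.step_le, h.size_le, h.le_size]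
  have e : fip E' E' = (1 - 2 * α * size A) * fip E' (errorE A) -
      2 * α * (m * fip E' (phi A (errorF A))) + fip E' (remainder α A) := by
    nth_rewrite 2 [hE']
    rw [errorE_gradientStep, fip_add_right, fip_add_right, fip_sub_right, fip_smul_right,
      fip_smul_right, fip_smul_right, fip_smul_right, fip_one_right, trace_errorE]
    ring
  rw [fip_self] at e
  rw [e]
  have t1 := mul_le_mul_of_nonneg_left (fip_le E' (errorE A)) hc
  have t2 := neg_abs_le (fip E' (phi A (errorF A)))
  have t3 : 2 * α * (m * -|fip E' (phi A (errorF A))|) ≤ 2 * α * (m * fip E' (phi A (errorF A))) := by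
    gcongr
  have t4 := (fip_le E' (remainder α A)).trans
    (mul_le_mul_of_nonneg_left h.fro_remainder_le (fro_nonneg E'))
  linarith

end IsControlled

/-! ### Contraction under a spectral gap, and stability of the gap. -/

/-- The spectral gap as a bound on the bilinear form `⟨X, ∑ᵢ Aᵢ Y Aᵢ*⟩` for traceless `Y`. -/
def GapBound (κ : ℝ) (A : Operator k m n) : Prop :=
  ∀ (X : Matrix (Fin m) (Fin m) ℝ) (Y : Matrix (Fin n) (Fin n) ℝ), Y.trace = 0 →
    |fip X (phi A Y)| ≤ κ / (√m * √n) * (fro X * fro Y)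

namespace IsControlled

variable {α g κ : ℝ} {A : Operator k m n}

lemma scaled_bound {c r x x' y κ α g N i : ℝ} (hr : 0 < r) (h : x' ^ 2 ≤ c * (x' * x) +
    2 * α * (r ^ 2 * i) + 25 * α * g * (r * N) * x') (hi : i ≤ κ / r * (x' * y))
    (hα : 0 ≤ α) :
    (x' / r) ^ 2 ≤ c * ((x' / r) * (x / r)) + 2 * α * (κ * ((x' / r) * y)) +
      25 * α * g * N * (x' / r) := by
  have h2 : x' ^ 2 ≤ c * (x' * x) + 2 * α * (r ^ 2 * (κ / r * (x' * y))) +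
      25 * α * g * (r * N) * x' := h.trans (by gcongr)
  have : c * ((x' / r) * (x / r)) + 2 * α * (κ * ((x' / r) * y)) + 25 * α * g * N * (x' / r) -
      (x' / r) ^ 2 = (c * (x' * x) + 2 * α * (r ^ 2 * (κ / r * (x' * y))) +
      25 * α * g * (r * N) * x' - x' ^ 2) / r ^ 2 := by field_simp
  have h3 := div_nonneg (sub_nonneg.2 h2) (sq_nonneg r)
  linarith

/-- Add the two inequalities and apply Cauchy–Schwarz in the plane: both the direct pairing of `(a',
b')` with `(a, b)` and the crossed one with `(b, a)` are at most `N' N`. Then cancel `N'`. -/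
lemma le_mul_of_sq_le {α g κ s a b a' b' N N' : ℝ} (hα : 0 ≤ α) (hg : 0 ≤ g) (hκ : 0 ≤ κ)
    (hc : 0 ≤ 1 - 2 * α * s) (nN : 0 ≤ N) (nN' : 0 ≤ N') (sN : N ^ 2 = a ^ 2 + b ^ 2)
    (sN' : N' ^ 2 = a' ^ 2 + b' ^ 2)
    (hE : a' ^ 2 ≤ (1 - 2 * α * s) * (a' * a) + 2 * α * (κ * (a' * b)) + 25 * α * g * N * a')
    (hF : b' ^ 2 ≤ (1 - 2 * α * s) * (b' * b) + 2 * α * (κ * (b' * a)) + 25 * α * g * N * b') :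
    N' ≤ (1 - 2 * α * (s - κ) + 60 * α * g) * N := by
  have c1 : a' * a + b' * b ≤ N' * N := by
    refine abs_le_of_sq_le_sq' ?_ (by positivity) |>.2
    rw [mul_pow, sN, sN']
    nlinarith [sq_nonneg (a' * b - b' * a)]
  have c2 : a' * b + b' * a ≤ N' * N := by
    refine abs_le_of_sq_le_sq' ?_ (by positivity) |>.2
    rw [mul_pow, sN, sN']
    nlinarith [sq_nonneg (a' * a - b' * b)]
  have c3 : a' ≤ N' := abs_le_of_sq_le_sq' (by nlinarith) nN' |>.2
  have c4 : b' ≤ N' := abs_le_of_sq_le_sq' (by nlinarith) nN' |>.2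
  have d1 := mul_le_mul_of_nonneg_left c1 hc
  have d2 := mul_le_mul_of_nonneg_left c2 (mul_nonneg hα hκ)
  have d3 : 25 * α * g * N * a' ≤ 25 * α * g * N * N' := by gcongr
  have d4 : 25 * α * g * N * b' ≤ 25 * α * g * N * N' := by gcongr
  have d5 : 0 ≤ α * g * N * N' := by positivity
  have main : N' * N' ≤ N' * ((1 - 2 * α * (s - κ) + 60 * α * g) * N) := by
    linarith
  rcases nN'.eq_or_lt with h0 | h0
  · rw [← h0]
    have : 0 ≤ 1 - 2 * α * (s - κ) + 60 * α * g := by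
      have := mul_nonneg hα hκ
      have := mul_nonneg hα hg
      linarith
    positivity
  · exact le_of_mul_le_mul_left main h0

lemma errorNorm_gradientStep_le (h : IsControlled α g A) (hκ : 0 ≤ κ) (hgap : GapBound κ A) :
    errorNorm (gradientStep α A) ≤
      (1 - 2 * α * (size A - κ) + 60 * α * g) * errorNorm A := by
  have hm' : 0 < √(m : ℝ) := Real.sqrt_pos.2 (Nat.cast_pos.2 h.dim_left)
  have hn' : 0 < √(n : ℝ) := Real.sqrt_pos.2 (Nat.cast_pos.2 h.dim_right)
  have hα := h.step_nonneg
  have hg := h.g_nonneg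
  have hc : 0 ≤ 1 - 2 * α * size A := by nlinarith [h.step_le, h.size_le, h.le_size]
  have hE := h.fro_errorE_gradientStep_sq_le
  have hF := h.flip.fro_errorE_gradientStep_sq_le
  rw [gradientStep_flip, errorE_flip, errorE_flip, errorF_flip, size_flip, errorNorm_flip,
    fip_phi_flip] at hF
  have gE := hgap (errorE (gradientStep α A)) (errorF A) (trace_errorF A)
  have gF := hgap (errorE A) (errorF (gradientStep α A)) (trace_errorF _)
  rw [← Real.sq_sqrt (Nat.cast_nonneg m : (0 : ℝ) ≤ m)] at hE
  rw [← Real.sq_sqrt (Nat.cast_nonneg n : (0 : ℝ) ≤ n)] at hF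
  simp only [Real.sqrt_sq (Real.sqrt_nonneg _)] at hE hF
  have hE' := scaled_bound (y := fro (errorF A) / √n) hm' hE
    (gE.trans_eq (by field_simp)) hα
  have hF' := scaled_bound (y := fro (errorE A) / √m) hn' hF
    (gF.trans_eq (by field_simp)) hα
  have sN := errorNorm_sq A
  have sN' := errorNorm_sq (gradientStep α A)
  have nN := errorNorm_nonneg A
  have nN' := errorNorm_nonneg (gradientStep α A)
  exact le_mul_of_sq_le hα hg hκ hc nN nN' sN sN' hE' hF'

lemma fro_conj_sub_le {p : ℕ} {α g : ℝ} {E X : Matrix (Fin p) (Fin p) ℝ} (hα : 0 ≤ α)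
    (hα1 : α ≤ 1 / 8) (hg1 : g ≤ 1 / 4) (hE : ‖E‖ ≤ g) :
    fro ((1 + α • E) * X * (1 + α • E) - X) ≤ 3 * α * g * fro X := by
  have hg : 0 ≤ g := (norm_nonneg _).trans hE
  have e : (1 + α • E) * X * (1 + α • E) - X = α • (E * X) + α • (X * E) + α ^ 2 • (E * X * E) := by
    simp only [mul_one, mul_add, add_mul, one_mul, smul_mul_assoc, mul_smul_comm]
    module
  have hX := fro_nonneg X
  have h1 : fro (E * X) ≤ g * fro X := (fro_mul_le _ _).trans (by gcongr)
  have h2 : fro (X * E) ≤ g * fro X := by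
    have : fro X * ‖E‖ ≤ fro X * g := by gcongr
    linarith [fro_mul_le' X E]
  have h3 : fro (E * X * E) ≤ g * fro X * g :=
    (fro_mul_le' _ _).trans (mul_le_mul h1 hE (norm_nonneg _) (by positivity))
  rw [e]
  have t1 := map_add_le_add fro (α • (E * X) + α • (X * E)) (α ^ 2 • (E * X * E))
  have t2 := map_add_le_add fro (α • (E * X)) (α • (X * E))
  rw [fro_smul, fro_smul, abs_of_nonneg hα] at t2
  rw [fro_smul, abs_of_nonneg (sq_nonneg α)] at t1
  have u1 := mul_le_mul_of_nonneg_left h1 hα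
  have u2 := mul_le_mul_of_nonneg_left h2 hα
  have u3 := mul_le_mul_of_nonneg_left h3 (sq_nonneg α)
  have u4 : α ^ 2 * (g * fro X * g) ≤ α * (g * fro X) := by
    have : (α * g) * (α * (g * fro X)) ≤ 1 * (α * (g * fro X)) := by
      gcongr
      nlinarith
    linarith
  linarith

lemma gapBound_gradientStep (h : IsControlled α g A) (hgap : GapBound κ A) :
    GapBound (κ + 60 * α * g) (gradientStep α A) := by
  intro X Y hY
  have hm' : 0 < √(m : ℝ) := Real.sqrt_pos.2 (Nat.cast_pos.2 h.dim_left)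
  have hn' : 0 < √(n : ℝ) := Real.sqrt_pos.2 (Nat.cast_pos.2 h.dim_right)
  have hα := h.step_nonneg
  have hg := h.g_nonneg
  set L := 1 + α • errorE A with hL
  set R := 1 + α • errorF A with hR
  have hLt : Lᵀ = L := by simp [hL, errorE_transpose]
  have e1 : fip X (phi (gradientStep α A) Y) = fip (L * X * L) (phi A (R * Y * R)) := by
    rw [phi_gradientStep, fip_eq_trace, fip_eq_trace, Matrix.transpose_mul, Matrix.transpose_mul,
      hLt, ← hL, ← hR, ← Matrix.mul_assoc, Matrix.trace_mul_comm]
    simp only [Matrix.mul_assoc]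
  -- Conjugation by `R` need not preserve trace zero, so the gap is applied only to the original
  -- pair `X, Y`; the differences are bounded without it.
  have e2 : fip (L * X * L) (phi A (R * Y * R)) = fip X (phi A Y) +
      fip X (phi A (R * Y * R - Y)) + fip (L * X * L - X) (phi A (R * Y * R)) := by
    have : phi A (R * Y * R) = phi A Y + phi A (R * Y * R - Y) := by
      rw [← phi_add]; congr 1; abel
    rw [fip_sub_left, this, fip_add_right, fip_add_right]
    ring
  have dX : fro (L * X * L - X) ≤ 3 * α * g * fro X :=
    fro_conj_sub_le hα h.step_le h.g_le h.normE
  have dY : fro (R * Y * R - Y) ≤ 3 * α * g * fro Y :=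
    fro_conj_sub_le hα h.step_le h.g_le h.normF
  have hX := fro_nonneg X
  have hYn := fro_nonneg Y
  have bY : fro (R * Y * R) ≤ 2 * fro Y := by
    have t := map_add_le_add fro Y (R * Y * R - Y)
    rw [add_sub_cancel] at t
    have : 3 * α * g * fro Y ≤ 1 * fro Y := by
      gcongr
      nlinarith [h.step_le, h.g_le]
    linarith
  have s := h.sqrt_marginals
  have f1 : |fip X (phi A (R * Y * R - Y))| ≤ 2 / (√m * √n) * (fro X * (3 * α * g * fro Y)) :=
    (abs_fip_phi_le _ _ _).trans (by gcongr)
  have f2 : |fip (L * X * L - X) (phi A (R * Y * R))| ≤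
      2 / (√m * √n) * ((3 * α * g * fro X) * (2 * fro Y)) :=
    (abs_fip_phi_le _ _ _).trans (by gcongr)
  rw [e1, e2]
  have d : 0 ≤ 42 * (α * g) / (√m * √n) * (fro X * fro Y) := by positivity
  calc _ ≤ |fip X (phi A Y)| + |fip X (phi A (R * Y * R - Y))| +
        |fip (L * X * L - X) (phi A (R * Y * R))| := abs_add_three _ _ _
    _ ≤ κ / (√m * √n) * (fro X * fro Y) + 2 / (√m * √n) * (fro X * (3 * α * g * fro Y)) +
        2 / (√m * √n) * ((3 * α * g * fro X) * (2 * fro Y)) :=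
        add_le_add (add_le_add (hgap X Y hY) f1) f2
    _ = (κ + 60 * α * g) / (√m * √n) * (fro X * fro Y) -
        42 * (α * g) / (√m * √n) * (fro X * fro Y) := by ring
    _ ≤ _ := by linarith

end IsControlled

end OneStep

end OperatorScaling

namespace OperatorScaling

/-! ### Singular values and Ky Fan's inequality. -/

section SingularValues

variable {E F : Type*} [NormedAddCommGroup E] [InnerProductSpace ℝ E] [FiniteDimensional ℝ E]
  [NormedAddCommGroup F] [InnerProductSpace ℝ F] [FiniteDimensional ℝ F]

lemma norm_apply_sq_eq_sum (T : E →ₗ[ℝ] F) {N : ℕ} (hN : Module.finrank ℝ E = N) (x : E) :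
    ‖T x‖ ^ 2 = ∑ i : Fin N, T.singularValues i ^ 2 *
      inner ℝ (T.isSymmetric_adjoint_comp_self.eigenvectorBasis hN i) x ^ 2 := by
  set b := T.isSymmetric_adjoint_comp_self.eigenvectorBasis hN
  have h1 : ‖T x‖ ^ 2 = inner ℝ x ((T.adjoint ∘ₗ T) x) := by
    rw [LinearMap.comp_apply, LinearMap.adjoint_inner_right, real_inner_self_eq_norm_sq]
  rw [h1, ← b.sum_inner_mul_inner]
  refine Finset.sum_congr rfl fun i _ => ?_
  have h2 := T.isSymmetric_adjoint_comp_self.eigenvectorBasis_apply_self_apply hN x i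
  rw [OrthonormalBasis.repr_apply_apply, OrthonormalBasis.repr_apply_apply] at h2
  rw [h2, T.sq_singularValues_fin hN, real_inner_comm]
  simp only [RCLike.ofReal_real_eq_id, id_eq, b]
  ring

/-- Ky Fan's inequality for two orthonormal vectors. -/
lemma norm_apply_sq_add_le (T : E →ₗ[ℝ] F) (hN : 2 ≤ Module.finrank ℝ E) {x y : E}
    (hx : ‖x‖ = 1) (hy : ‖y‖ = 1) (hxy : inner ℝ x y = 0) :
    ‖T x‖ ^ 2 + ‖T y‖ ^ 2 ≤ T.singularValues 0 ^ 2 + T.singularValues 1 ^ 2 := by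
  set b := T.isSymmetric_adjoint_comp_self.eigenvectorBasis rfl with hb
  set w : Fin (Module.finrank ℝ E) → ℝ := fun i => inner ℝ (b i) x ^ 2 + inner ℝ (b i) y ^ 2
  let i0 : Fin (Module.finrank ℝ E) := ⟨0, by omega⟩
  have hw : ∑ i, w i = 2 := by
    have e : ∀ z : E, ∑ i, inner ℝ (b i) z ^ 2 = ‖z‖ ^ 2 := fun z => by
      rw [← real_inner_self_eq_norm_sq, ← b.sum_inner_mul_inner]
      exact Finset.sum_congr rfl fun i _ => by rw [real_inner_comm, sq]
    simp only [w, Finset.sum_add_distrib, e, hx, hy]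
    norm_num
  -- Bessel's inequality for the orthonormal pair `x, y`. The weights sum to two and the top one is
  -- at most one, so the weighted sum of squares cannot exceed the top two.
  have hw0 : w i0 ≤ 1 := by
    have hb1 : ‖b i0‖ = 1 := b.orthonormal.1 i0
    have h := sq_nonneg ‖b i0 - (inner ℝ (b i0) x) • x - (inner ℝ (b i0) y) • y‖
    rw [← real_inner_self_eq_norm_sq] at h
    simp only [inner_sub_left, inner_sub_right, inner_smul_left, inner_smul_right,
      real_inner_self_eq_norm_sq, hx, hy, hb1, hxy, real_inner_comm x y,
      real_inner_comm (b i0) x, real_inner_comm (b i0) y, RCLike.conj_to_real] at h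
    simp only [w]
    nlinarith
  have hanti := T.singularValues_antitone
  rw [norm_apply_sq_eq_sum T rfl, norm_apply_sq_eq_sum T rfl, ← Finset.sum_add_distrib, ← hb]
  have key : ∀ i : Fin (Module.finrank ℝ E),
      T.singularValues i ^ 2 * inner ℝ (b i) x ^ 2 + T.singularValues i ^ 2 * inner ℝ (b i) y ^ 2 ≤
      T.singularValues 1 ^ 2 * w i +
        if i = i0 then (T.singularValues 0 ^ 2 - T.singularValues 1 ^ 2) * w i0 else 0 := by
    intro i
    rw [← mul_add]
    split_ifs with hi
    · subst hi
      simp only [i0, w]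
      linarith
    · have h1 : 1 ≤ (i : ℕ) := by
        rcases Nat.eq_zero_or_pos (i : ℕ) with h | h
        · exact absurd (Fin.ext h) hi
        · exact h
      have := pow_le_pow_left₀ (T.singularValues_nonneg i) (hanti h1) 2
      rw [add_zero]
      exact mul_le_mul_of_nonneg_right this (by positivity)
  refine (Finset.sum_le_sum fun i _ => key i).trans ?_
  rw [Finset.sum_add_distrib, ← Finset.mul_sum, hw, Finset.sum_ite_eq' Finset.univ i0]
  have := pow_le_pow_left₀ (T.singularValues_nonneg 1) (hanti zero_le_one) 2
  simp only [Finset.mem_univ, if_true]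
  nlinarith

lemma singularValues_zero_le (T : E →ₗ[ℝ] F) (hN : 0 < Module.finrank ℝ E) {c : ℝ}
    (hc : ∀ x, ‖T x‖ ≤ c * ‖x‖) : T.singularValues 0 ≤ c := by
  set b := T.isSymmetric_adjoint_comp_self.eigenvectorBasis rfl with hb
  let i0 : Fin (Module.finrank ℝ E) := ⟨0, hN⟩
  have hb1 : ‖b i0‖ = 1 := b.orthonormal.1 i0
  have h := norm_apply_sq_eq_sum T rfl (b i0)
  have e : ∀ i : Fin (Module.finrank ℝ E), T.singularValues i ^ 2 * inner ℝ (b i) (b i0) ^ 2 =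
      if i = i0 then T.singularValues 0 ^ 2 else 0 := fun i => by
    rw [b.inner_eq_ite]
    split_ifs with hi
    · subst hi; simp [i0]
    · simp
  rw [← hb, Finset.sum_congr rfl fun i _ => e i, Finset.sum_ite_eq'] at h
  simp only [Finset.mem_univ, if_true] at h
  have h2 := hc (b i0)
  rw [hb1, mul_one] at h2
  have hc0 := (norm_nonneg _).trans h2
  refine abs_le_of_sq_le_sq' ?_ hc0 |>.2
  rw [← h]
  gcongr

end SingularValues

/-! ### The initial operator: spectral gap, balance and normalization. -/

section InitialState

variable {k m n : ℕ}

lemma naturalMatrix_apply_vecL (A : Operator k m n) (Y : Matrix (Fin n) (Fin n) ℝ) :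
    Matrix.toEuclideanLin (naturalMatrix A) (vecL Y) = vecL (phi A Y) := by
  ext q
  rw [vecL_apply]
  simp only [Matrix.toLpLin_apply, phi, naturalMatrix, Matrix.sum_mulVec, Matrix.sum_apply,
    Finset.sum_apply]
  refine Finset.sum_congr rfl fun i _ => ?_
  simp only [Matrix.mulVec, dotProduct, Matrix.kroneckerMap_apply, Matrix.mul_apply,
    Matrix.transpose_apply, Fintype.sum_prod_type, Finset.sum_mul]
  rw [Finset.sum_comm]
  refine Finset.sum_congr rfl fun a _ => Finset.sum_congr rfl fun c _ => ?_
  change _ * vecL Y (c, a) = _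
  rw [vecL_apply]
  ring

lemma vecL_surjective : Function.Surjective (vecL (m := m) (n := n)) :=
  fun x => ⟨Matrix.of fun a b => x (a, b), rfl⟩

lemma fro_one : fro (1 : Matrix (Fin m) (Fin m) ℝ) = √m := by
  rw [← Real.sqrt_sq (fro_nonneg 1), ← fip_self, fip_one_right, Matrix.trace_one, Fintype.card_fin]

/-- The identity need not be a top singular vector, so it cannot simply be split off. Ky Fan's
inequality for `I/√n` and `Y/‖Y‖` suffices: the image of `I/√n` has squared norm at least `s²/(mn)`,
and the rest of the budget bounds the image of `Y`. -/
lemma fro_phi_sq_le (A : Operator k m n) (hm : 0 < m) (hn : 2 ≤ n) {B σ : ℝ}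
    (hB : √‖leftMarginal A‖ * √‖rightMarginal A‖ ≤ B)
    (hσ : (Matrix.toEuclideanLin (naturalMatrix A)).singularValues 1 ≤ σ)
    (Y : Matrix (Fin n) (Fin n) ℝ) (hY : Y.trace = 0) :
    fro (phi A Y) ^ 2 ≤ (B ^ 2 + σ ^ 2 - size A ^ 2 / (m * n)) * fro Y ^ 2 := by
  set T := Matrix.toEuclideanLin (naturalMatrix A) with hT
  have hm' : (0 : ℝ) < m := Nat.cast_pos.2 hm
  have hn' : (0 : ℝ) < n := Nat.cast_pos.2 (by omega)
  have hdim : 2 ≤ Module.finrank ℝ (EuclideanSpace ℝ (Fin n × Fin n)) := by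
    rw [finrank_euclideanSpace, Fintype.card_prod, Fintype.card_fin]; nlinarith
  have hB0 : 0 ≤ B := le_trans (by positivity) hB
  have h0 : T.singularValues 0 ≤ B := by
    refine singularValues_zero_le T (by omega) fun x => ?_
    obtain ⟨X, rfl⟩ := vecL_surjective x
    rw [naturalMatrix_apply_vecL, ← fro_eq_norm, ← fro_eq_norm]
    exact (fro_phi_le A X).trans (mul_le_mul_of_nonneg_right hB (fro_nonneg X))
  have h0' := pow_le_pow_left₀ (T.singularValues_nonneg 0) h0 2
  have h1' := pow_le_pow_left₀ (T.singularValues_nonneg 1) hσ 2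
  rcases (fro_nonneg Y).eq_or_lt with hz | hpos
  · have h2 := fro_phi_le A Y
    rw [← hz, mul_zero] at h2
    rw [le_antisymm h2 (fro_nonneg _), ← hz]
    simp
  have hone : ‖vecL ((√n)⁻¹ • (1 : Matrix (Fin n) (Fin n) ℝ))‖ = 1 := by
    rw [← fro_eq_norm, fro_smul, fro_one, abs_of_nonneg (by positivity)]
    exact inv_mul_cancel₀ (by positivity)
  have hy : ‖vecL ((fro Y)⁻¹ • Y)‖ = 1 := by
    rw [← fro_eq_norm, fro_smul, abs_of_nonneg (by positivity)]
    exact inv_mul_cancel₀ hpos.ne'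
  have horth : inner ℝ (vecL ((√n)⁻¹ • (1 : Matrix (Fin n) (Fin n) ℝ))) (vecL ((fro Y)⁻¹ • Y)) = 0 := by
    change fip _ _ = 0
    rw [fip_smul_right, fip_comm, fip_smul_right, fip_one_right, hY]
    simp
  have hK := norm_apply_sq_add_le T hdim hone hy horth
  rw [naturalMatrix_apply_vecL, naturalMatrix_apply_vecL, ← fro_eq_norm, ← fro_eq_norm, phi_smul,
    phi_smul, phi_one, fro_smul, fro_smul, mul_pow, mul_pow, sq_abs, sq_abs, inv_pow, inv_pow,
    Real.sq_sqrt hn'.le] at hK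
  have hP : size A ^ 2 / m ≤ fro (leftMarginal A) ^ 2 := by
    have h := pow_le_pow_left₀ (abs_nonneg _) (abs_fip_le (leftMarginal A) 1) 2
    rw [fip_one_right, trace_leftMarginal, fro_one, mul_pow, sq_abs, Real.sq_sqrt hm'.le] at h
    rwa [div_le_iff₀ hm']
  have hP' : size A ^ 2 / (m * n) ≤ (n : ℝ)⁻¹ * fro (leftMarginal A) ^ 2 := by
    calc size A ^ 2 / (m * n) = (n : ℝ)⁻¹ * (size A ^ 2 / m) := by field_simp
      _ ≤ _ := by gcongr
  have hfin : (fro Y ^ 2)⁻¹ * fro (phi A Y) ^ 2 ≤ B ^ 2 + σ ^ 2 - size A ^ 2 / (m * n) := by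
    linarith
  rwa [inv_mul_le_iff₀ (by positivity), mul_comm] at hfin

lemma gapBound_of_hasSpectralGap {ε lam : ℝ} (A : Operator k m n) (hm : 0 < m) (hn : 2 ≤ n)
    (hlam1 : lam ≤ 1) (hlam : 0 ≤ lam) (hε0 : 0 ≤ ε) (hε : 12 * ε ≤ lam ^ 2)
    (hE : ‖errorE A‖ ≤ ε * size A) (hF : ‖errorF A‖ ≤ ε * size A) (hgap : HasSpectralGap lam A) :
    GapBound ((1 - lam / 2) * size A) A := by
  have hs : 0 ≤ size A := by unfold size; positivity
  have hm' : (0 : ℝ) < m := Nat.cast_pos.2 hm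
  have hn' : (0 : ℝ) < n := Nat.cast_pos.2 (by omega)
  have hP := opNorm_leftMarginal_le A hE
  have hQ := opNorm_rightMarginal_le A hF
  set r := √(m : ℝ) * √(n : ℝ) with hr
  have hrpos : 0 < r := by positivity
  have hr2 : r ^ 2 = m * n := by rw [hr, mul_pow, Real.sq_sqrt hm'.le, Real.sq_sqrt hn'.le]
  have hB : √‖leftMarginal A‖ * √‖rightMarginal A‖ ≤ (1 + ε) * size A / r := by
    rw [← Real.sqrt_mul (norm_nonneg _)]
    refine Real.sqrt_le_iff.2 ⟨by positivity, ?_⟩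
    rw [div_pow, hr2, le_div_iff₀ (by positivity)]
    calc _ = (m * ‖leftMarginal A‖) * (n * ‖rightMarginal A‖) := by ring
      _ ≤ (size A + ε * size A) * (size A + ε * size A) :=
        mul_le_mul hP hQ (by positivity) (by positivity)
      _ = _ := by ring
  rw [HasSpectralGap, Real.sqrt_mul hm'.le, ← hr] at hgap
  intro X Y hY
  have h := fro_phi_sq_le A hm hn hB hgap Y hY
  have hfro : fro (phi A Y) ≤ (1 - lam / 2) * size A / r * fro Y := by
    have hnn : 0 ≤ (1 - lam / 2) * size A / r * fro Y :=
      mul_nonneg (div_nonneg (mul_nonneg (by linarith) hs) hrpos.le) (fro_nonneg Y)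
    refine abs_le_of_sq_le_sq' ?_ hnn |>.2
    refine h.trans ?_
    rw [mul_pow _ (fro Y)]
    refine mul_le_mul_of_nonneg_right ?_ (sq_nonneg (fro Y))
    rw [← hr2]
    have e : ((1 + ε) * size A / r) ^ 2 + ((1 - lam) * (size A / r)) ^ 2 - size A ^ 2 / r ^ 2 =
        ((1 + ε) ^ 2 + (1 - lam) ^ 2 - 1) * (size A / r) ^ 2 := by ring
    have e2 : ((1 - lam / 2) * size A / r) ^ 2 = (1 - lam / 2) ^ 2 * (size A / r) ^ 2 := by ring
    rw [e, e2]
    refine mul_le_mul_of_nonneg_right ?_ (sq_nonneg _)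
    -- It remains to see `(1+ε)² + (1-λ)² - 1 ≤ (1-λ/2)²`; with `ε² ≤ ε` and `λ² ≤ λ` this reduces
    -- to `3ε ≤ λ²/4`, which is `hε`.
    have hl : lam ^ 2 ≤ lam := by nlinarith
    have he : ε ^ 2 ≤ ε := by nlinarith
    nlinarith
  calc |fip X (phi A Y)| ≤ fro X * fro (phi A Y) := abs_fip_le _ _
    _ ≤ fro X * ((1 - lam / 2) * size A / r * fro Y) :=
        mul_le_mul_of_nonneg_left hfro (fro_nonneg X)
    _ = _ := by ring

lemma norm_errorE_le_of_isNearlyDoublyBalanced {ε : ℝ} {A : Operator k m n} (hm : 0 < m)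
    (h : IsNearlyDoublyBalanced ε A) (hε : 0 ≤ ε) : ‖errorE A‖ ≤ ε * size A := by
  have hs : 0 ≤ size A := by unfold size; positivity
  have hm' : (0 : ℝ) < m := Nat.cast_pos.2 hm
  refine opNorm_le_of_posSemidef (by positivity) (errorE_transpose A) ?_ ?_
  · convert! h.1.smul hm'.le using 1
    rw [errorE, smul_sub, smul_smul]
    have : (m : ℝ) * ((1 - ε) * (size A / m)) = (1 - ε) * size A := by field_simp
    rw [this]
    module
  · convert! h.2.1.smul hm'.le using 1
    rw [errorE, smul_sub, smul_smul]
    have : (m : ℝ) * ((1 + ε) * (size A / m)) = (1 + ε) * size A := by field_simp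
    rw [this]
    module

lemma IsNearlyDoublyBalanced.flip {ε : ℝ} {A : Operator k m n}
    (h : IsNearlyDoublyBalanced ε A) : IsNearlyDoublyBalanced ε (flip A) := by
  rw [IsNearlyDoublyBalanced, size_flip]
  exact ⟨h.2.2.1, h.2.2.2, h.1, h.2.1⟩

lemma norm_errorF_le_of_isNearlyDoublyBalanced {ε : ℝ} {A : Operator k m n} (hn : 0 < n)
    (h : IsNearlyDoublyBalanced ε A) (hε : 0 ≤ ε) : ‖errorF A‖ ≤ ε * size A := by
  rw [← errorE_flip, ← size_flip]
  exact norm_errorE_le_of_isNearlyDoublyBalanced hn h.flip hε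

/-- The left marginal has trace `s`, so the trace of the lower Loewner bound reads `(1 - ε) s ≤ s`.
-/
lemma IsNearlyDoublyBalanced.nonneg {ε : ℝ} {A : Operator k m n} (hs : 0 < size A) (hm : 0 < m)
    (h : IsNearlyDoublyBalanced ε A) : 0 ≤ ε := by
  have hm' : (0 : ℝ) < m := Nat.cast_pos.2 hm
  have h1 : 0 ≤ (leftMarginal A - ((1 - ε) * (size A / m)) •
      (1 : Matrix (Fin m) (Fin m) ℝ)).trace := h.1.trace_nonneg
  rw [Matrix.trace_sub, Matrix.trace_smul, trace_leftMarginal, Matrix.trace_one, Fintype.card_fin,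
    smul_eq_mul] at h1
  have : (1 - ε) * (size A / m) * m = (1 - ε) * size A := by field_simp
  nlinarith

lemma posSemidef_leftMarginal_of_norm_errorE_le {η : ℝ} {A : Operator k m n} (hm : 0 < m)
    (h : ‖errorE A‖ ≤ η * size A) :
    (leftMarginal A - ((1 - η) * (size A / m)) • (1 : Matrix (Fin m) (Fin m) ℝ)).PosSemidef ∧
    (((1 + η) * (size A / m)) • (1 : Matrix (Fin m) (Fin m) ℝ) - leftMarginal A).PosSemidef := by
  have hm' : (0 : ℝ) < m := Nat.cast_pos.2 hm
  have hP : leftMarginal A = (m : ℝ)⁻¹ • (size A • 1 - errorE A) := by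
    rw [← smul_leftMarginal, inv_smul_smul₀ hm'.ne']
  constructor
  · convert! (posSemidef_of_opNorm_le (errorE_transpose A) h).smul (inv_nonneg.2 hm'.le) using 1
    rw [hP]
    module
  · convert! (posSemidef_of_opNorm_le (X := -errorE A) (c := η * size A)
      (by rw [Matrix.transpose_neg, errorE_transpose])
      (by rwa [norm_neg])).smul (inv_nonneg.2 hm'.le) using 1
    rw [hP]
    module

lemma isNearlyDoublyBalanced_of_norm_le {η : ℝ} {A : Operator k m n} (hm : 0 < m) (hn : 0 < n)
    (hE : ‖errorE A‖ ≤ η * size A) (hF : ‖errorF A‖ ≤ η * size A) :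
    IsNearlyDoublyBalanced η A := by
  obtain ⟨h1, h2⟩ := posSemidef_leftMarginal_of_norm_errorE_le hm hE
  have hF' : ‖errorE (OperatorScaling.flip A)‖ ≤ η * size (OperatorScaling.flip A) := by
    rwa [errorE_flip, size_flip]
  obtain ⟨h3, h4⟩ := posSemidef_leftMarginal_of_norm_errorE_le hn hF'
  rw [leftMarginal_flip, size_flip] at h3 h4
  exact ⟨h1, h2, h3, h4⟩

lemma phi_smul_operator (c : ℝ) (A : Operator k m n) (Y : Matrix (Fin n) (Fin n) ℝ) :
    phi (fun i => c • A i) Y = c ^ 2 • phi A Y := by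
  simp only [phi, Finset.smul_sum, Matrix.transpose_smul, Matrix.smul_mul, Matrix.mul_smul,
    smul_smul, sq]

lemma size_smul_operator (c : ℝ) (A : Operator k m n) :
    size (fun i => c • A i) = c ^ 2 * size A := by
  rw [← trace_leftMarginal, ← phi_one, phi_smul_operator, Matrix.trace_smul, phi_one,
    trace_leftMarginal, smul_eq_mul]

lemma errorE_smul_operator (c : ℝ) (A : Operator k m n) :
    errorE (fun i => c • A i) = c ^ 2 • errorE A := by
  rw [errorE, errorE, ← phi_one, phi_smul_operator, size_smul_operator, phi_one]
  module

lemma flip_smul_operator (c : ℝ) (A : Operator k m n) :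
    flip (fun i => c • A i) = fun i => c • flip A i := by
  funext i
  exact Matrix.transpose_smul _ _

lemma errorF_smul_operator (c : ℝ) (A : Operator k m n) :
    errorF (fun i => c • A i) = c ^ 2 • errorF A := by
  rw [← errorE_flip, flip_smul_operator, errorE_smul_operator, errorE_flip]

lemma inv_sqrt_size_sq (A : Operator k m n) : (√(size A))⁻¹ ^ 2 = (size A)⁻¹ := by
  have hs : 0 ≤ size A := by unfold size; positivity
  rw [inv_pow, Real.sq_sqrt hs]

lemma size_normalize {A : Operator k m n} (hs : 0 < size A) : size (normalize A) = 1 := by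
  unfold normalize
  rw [size_smul_operator, inv_sqrt_size_sq, inv_mul_cancel₀ hs.ne']

lemma norm_errorE_normalize_le {ε : ℝ} {A : Operator k m n} (hs : 0 < size A)
    (h : ‖errorE A‖ ≤ ε * size A) : ‖errorE (normalize A)‖ ≤ ε := by
  unfold normalize
  rw [errorE_smul_operator, inv_sqrt_size_sq, norm_smul, norm_inv, Real.norm_of_nonneg hs.le,
    inv_mul_le_iff₀ hs]
  linarith

lemma norm_errorF_normalize_le {ε : ℝ} {A : Operator k m n} (hs : 0 < size A)
    (h : ‖errorF A‖ ≤ ε * size A) : ‖errorF (normalize A)‖ ≤ ε := by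
  unfold normalize
  rw [errorF_smul_operator, inv_sqrt_size_sq, norm_smul, norm_inv, Real.norm_of_nonneg hs.le,
    inv_mul_le_iff₀ hs]
  linarith

lemma gapBound_normalize {κ : ℝ} {A : Operator k m n} (hs : 0 < size A)
    (h : GapBound (κ * size A) A) : GapBound κ (normalize A) := by
  intro X Y hY
  unfold normalize
  rw [phi_smul_operator, inv_sqrt_size_sq, fip_smul_right, abs_mul, abs_of_pos (inv_pos.2 hs),
    inv_mul_le_iff₀ hs]
  refine (h X Y hY).trans_eq ?_
  ring

lemma fro_le_of_norm_le {X : Matrix (Fin m) (Fin m) ℝ} {ε : ℝ} (h : ‖X‖ ≤ ε) :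
    fro X ≤ √m * ε := by
  have h1 := fro_mul_le X (1 : Matrix (Fin m) (Fin m) ℝ)
  rw [mul_one, fro_one] at h1
  have := Real.sqrt_nonneg (m : ℝ)
  nlinarith

lemma errorNorm_le {ε : ℝ} {A : Operator k m n} (hm : 0 < m) (hn : 0 < n)
    (hE : ‖errorE A‖ ≤ ε) (hF : ‖errorF A‖ ≤ ε) : errorNorm A ≤ 2 * ε := by
  have hm' : 0 < √(m : ℝ) := by positivity
  have hn' : 0 < √(n : ℝ) := by positivity
  have hε : 0 ≤ ε := (norm_nonneg _).trans hE
  have a : fro (errorE A) / √m ≤ ε := (div_le_iff₀' hm').2 (fro_le_of_norm_le hE)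
  have b : fro (errorF A) / √n ≤ ε := (div_le_iff₀' hn').2 (fro_le_of_norm_le hF)
  have a0 : 0 ≤ fro (errorE A) / √m := div_nonneg (fro_nonneg _) hm'.le
  have b0 : 0 ≤ fro (errorF A) / √n := div_nonneg (fro_nonneg _) hn'.le
  refine Real.sqrt_le_iff.2 ⟨by positivity, ?_⟩
  nlinarith

lemma isUnit_one_add_of_norm_lt {X : Matrix (Fin m) (Fin m) ℝ} (h : ‖X‖ < 1) : IsUnit (1 + X) := by
  have := (Units.oneSub (-X) (by rwa [norm_neg])).isUnit
  rwa [Units.val_oneSub, sub_neg_eq_add] at this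

lemma isScaling_normalize {A : Operator k m n} (hs : 0 < size A) : IsScaling A (normalize A) := by
  refine ⟨(√(size A))⁻¹ • 1, 1, ?_, isUnit_one, fun i => by simp [normalize]⟩
  exact (isUnit_one).smul (Units.mk0 (√(size A))⁻¹ (inv_ne_zero (Real.sqrt_pos.2 hs).ne'))

lemma IsScaling.gradientStep {α g : ℝ} {A B : Operator k m n} (h : IsScaling A B)
    (hB : IsControlled α g B) : IsScaling A (gradientStep α B) := by
  obtain ⟨L, R, hL, hR, e⟩ := h
  have small : ∀ {p : ℕ} {X : Matrix (Fin p) (Fin p) ℝ}, ‖X‖ ≤ g → ‖α • X‖ < 1 := fun hX => by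
    rw [norm_smul, Real.norm_of_nonneg hB.step_nonneg]
    nlinarith [hB.step_le, hB.g_le, hB.step_nonneg, hB.g_nonneg]
  refine ⟨(1 + α • errorE B) * L, R * (1 + α • errorF B),
    (isUnit_one_add_of_norm_lt (small hB.normE)).mul hL,
    hR.mul (isUnit_one_add_of_norm_lt (small hB.normF)), fun i => ?_⟩
  simp only [OperatorScaling.gradientStep, e, Matrix.mul_assoc]

end InitialState

end OperatorScaling

namespace OperatorScaling

/-! ### The scalar bootstrap argument. -/

section Dynamics

lemma one_sub_pow_le_exp {x : ℝ} (hx : x ≤ 1) (t : ℕ) : (1 - x) ^ t ≤ Real.exp (-(x * t)) := by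
  calc (1 - x) ^ t ≤ Real.exp (-x) ^ t :=
        pow_le_pow_left₀ (by linarith) (Real.one_sub_le_exp_neg x) t
    _ = _ := by rw [← Real.exp_nat_mul]; congr 1; ring

set_option maxHeartbeats 1000000 in
/-- Linear convergence of the scalar quantities that control gradient descent: `s` is the size,
`e` and `f` are the operator norms of the errors, `N` is their weighted Frobenius norm and `κ` bounds
the second singular value. -/
lemma linear_convergence {α lam ε L M : ℝ} {s e f N κ : ℕ → ℝ} {p : ℕ → Prop}
    (hα : 0 < α) (hα1 : α ≤ 1 / 8) (hlam : 0 < lam) (hlam1 : lam ≤ 1) (hε : 0 ≤ ε)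
    (hL : 1 / 2 ≤ L) (hC : 100000 * ε * L ≤ lam ^ 2) (hM0 : 0 ≤ M) (hM : M ≤ Real.exp (L / 2))
    (he0 : ∀ t, 0 ≤ e t) (hf0 : ∀ t, 0 ≤ f t)
    (heN : ∀ t, e t ≤ M * N t) (hs : s 0 = 1) (he : e 0 ≤ ε) (hf : f 0 ≤ ε) (hN : N 0 ≤ 2 * ε)
    (hNn : ∀ t, 0 ≤ N t) (hκ : κ 0 = 1 - lam / 2)
    (hκs : ∀ t, κ (t + 1) = κ t + 60 * α * max (e t) (f t)) (hp : p 0)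
    (hstep : ∀ t, |s t - 1| ≤ 1 / 4 → max (e t) (f t) ≤ 1 / 4 → 0 ≤ κ t → p t →
      N (t + 1) ≤ (1 - 2 * α * (s t - κ t) + 60 * α * max (e t) (f t)) * N t ∧
      e (t + 1) ≤ (1 - 2 * α * s t) * e t + 2 * α * s t * f t + 60 * α * max (e t) (f t) ^ 2 ∧
      f (t + 1) ≤ (1 - 2 * α * s t) * f t + 2 * α * s t * e t + 60 * α * max (e t) (f t) ^ 2 ∧
      |s (t + 1) - s t| ≤ 60 * α * max (e t) (f t) ^ 2 ∧ p (t + 1)) (t : ℕ) :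
    N t ≤ 2 * ε * (1 - α * lam / 4) ^ t ∧ |s t - 1| ≤ 1 / 4 ∧ p t := by
  have hαl : 0 < α * lam := mul_pos hα hlam
  have hαl1 : α * lam ≤ 1 := by nlinarith
  set ρ := 1 - α * lam / 4 with hρ
  have hρ0 : 0 < ρ := by rw [hρ]; linarith
  have hρ1 : ρ ≤ 1 := by rw [hρ]; linarith
  have hεs : 50000 * ε ≤ lam ^ 2 := by nlinarith
  have hεl : 50000 * ε ≤ lam := by nlinarith
  have hεL : ε * (L / lam) ≤ lam / 100000 := by
    rw [← mul_div_assoc, div_le_iff₀ hlam]; linarith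
  -- `T` ends the early phase: long enough that `ρ ^ T` cancels `M ≤ exp (L/2)`, short enough that
  -- `ε α T` is small against `lam`.
  obtain ⟨T, hT1, hT2⟩ : ∃ T : ℕ, 2 * L ≤ α * lam * T ∧ α * T ≤ 4 * (L / lam) := by
    refine ⟨⌈2 * L / (α * lam)⌉₊, ?_, ?_⟩
    · rw [← div_le_iff₀' hαl]; exact Nat.le_ceil _
    · have h := Nat.ceil_lt_add_one (show 0 ≤ 2 * L / (α * lam) by positivity)
      have h1 : α * (2 * L / (α * lam)) = 2 * (L / lam) := by field_simp
      have h2 : 1 / 2 ≤ L / lam := by rw [le_div_iff₀ hlam]; linarith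
      have h3 := mul_le_mul_of_nonneg_left h.le hα.le
      linarith
  have hTε : ε * (α * T) ≤ lam / 25000 := by
    have := mul_le_mul_of_nonneg_left hT2 hε
    linarith
  have hMρ : M * ρ ^ T ≤ 1 := by
    have h1 : ρ ^ T ≤ Real.exp (-(L / 2)) := by
      refine (one_sub_pow_le_exp (by linarith) T).trans (Real.exp_le_exp.2 ?_)
      linarith
    calc M * ρ ^ T ≤ Real.exp (L / 2) * Real.exp (-(L / 2)) :=
          mul_le_mul hM h1 (by positivity) (by positivity)
      _ = 1 := by rw [← Real.exp_add]; simp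
  -- Closed form of the sum of `α · 6ε ρ^(j - T)` over `j < t`, with truncated subtraction: linear
  -- up to `T`, geometric afterwards. It dominates the accumulated `α max (e, f)`.
  set D : ℕ → ℝ := fun t => 6 * ε * (α * (min t T : ℕ)) + 24 * ε / lam * (1 - ρ ^ (t - T)) with hD
  have hDstep : ∀ t, D (t + 1) = D t + α * (6 * ε * ρ ^ (t - T)) := fun t => by
    simp only [hD]
    rcases lt_or_ge t T with h | h
    · rw [min_eq_left h.le, min_eq_left h, Nat.sub_eq_zero_of_le h.le, Nat.sub_eq_zero_of_le h]
      push_cast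
      ring
    · rw [min_eq_right h, min_eq_right (by omega), Nat.succ_sub h, pow_succ, hρ]
      field_simp
      ring
  have hDle : ∀ t, 60 * D t ≤ lam / 16 := fun t => by
    have h1 : ε * (α * (min t T : ℕ)) ≤ ε * (α * T) := by
      gcongr
      exact min_le_right _ _
    have h2 : 24 * ε / lam * (1 - ρ ^ (t - T)) ≤ 24 * ε / lam * 1 := by
      gcongr
      linarith [pow_nonneg hρ0.le (t - T)]
    have h3 : ε / lam ≤ lam / 50000 := by
      rw [div_le_iff₀ hlam]; linarith
    have h4 : 24 * ε / lam * 1 = 24 * (ε / lam) := by ring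
    simp only [hD]
    linarith
  have inv : ∀ t : ℕ, N t ≤ 2 * ε * ρ ^ t ∧ |s t - 1| ≤ 60 * D t ∧ 0 ≤ κ t ∧
      κ t ≤ 1 - lam / 2 + 60 * D t ∧
      (t ≤ T → e t ≤ ε + 240 * ε * (ε * (α * t)) ∧ f t ≤ ε + 240 * ε * (ε * (α * t))) ∧
      (T ≤ t → f t ≤ 6 * ε * ρ ^ (t - T)) ∧ p t := by
    intro t
    induction t with
    | zero =>
      have : D 0 = 0 := by simp [hD]
      refine ⟨by simpa using hN, by simp [this, hs], by linarith, by simp [this, hκ],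
        fun _ => by simpa using ⟨he, hf⟩, fun _ => ?_, hp⟩
      simp
      linarith
    | succ t ih =>
      obtain ⟨iN, is, iκ0, iκ, i4, i5, ip⟩ := ih
      -- Only `e` is recovered from the Frobenius bound `M N`; `f` has no such comparison here.
      have hlate : T ≤ t → e t ≤ 2 * ε * ρ ^ (t - T) := fun hTt => by
        calc e t ≤ M * (2 * ε * ρ ^ t) := (heN t).trans (by gcongr)
          _ = 2 * ε * (M * ρ ^ T) * ρ ^ (t - T) := by
            rw [← Nat.add_sub_cancel' hTt, pow_add, Nat.add_sub_cancel_left]; ring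
          _ ≤ 2 * ε * 1 * ρ ^ (t - T) := by gcongr
          _ = _ := by ring
      -- While both norms are at most `2ε`, a step adds at most `60α(2ε)² = 240αε²`; over `T` steps
      -- this totals less than `ε`.
      have hearly : t ≤ T → ε + 240 * ε * (ε * (α * t)) ≤ 2 * ε := fun htT => by
        have h1 : ε * (α * t) ≤ ε * (α * T) := by gcongr
        have : 240 * ε * (ε * (α * t)) ≤ 240 * ε * (1 / 240) := by
          gcongr
          linarith
        linarith
      set g := max (e t) (f t) with hg
      have hg0 : 0 ≤ g := (he0 t).trans (le_max_left _ _)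
      have hgb : g ≤ 6 * ε * ρ ^ (t - T) := by
        rcases le_total t T with h | h
        · rw [Nat.sub_eq_zero_of_le h, pow_zero]
          exact max_le (by linarith [(i4 h).1, hearly h]) (by linarith [(i4 h).2, hearly h])
        · refine max_le ((hlate h).trans ?_) (i5 h)
          gcongr
          norm_num
      have hpow1 : ρ ^ (t - T) ≤ 1 := pow_le_one₀ hρ0.le hρ1
      have hg6 : g ≤ 6 * ε :=
        hgb.trans (mul_le_of_le_one_right (by linarith) hpow1)
      have hDt := hDle t
      have hs4 : |s t - 1| ≤ 1 / 4 := by linarith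
      have hs' := abs_le.1 hs4
      have hs16 := abs_le.1 (is.trans hDt)
      obtain ⟨sN, se, sf, ss, sp⟩ := hstep t hs4 (by linarith) iκ0 ip
      have hαg : 60 * α * g ≤ α * (lam / 4) := by
        have := mul_le_mul_of_nonneg_left (show 60 * g ≤ lam / 4 by linarith) hα.le
        linarith
      have hDg : 60 * α * g ≤ 60 * (α * (6 * ε * ρ ^ (t - T))) := by
        have := mul_le_mul_of_nonneg_left hgb hα.le
        linarith
      have hg2 : 60 * α * g ^ 2 ≤ 60 * α * g := by
        have : g ^ 2 ≤ g := pow_le_of_le_one hg0 (by linarith) two_ne_zero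
        gcongr
      have hcs : 0 ≤ 1 - 2 * α * s t := by
        have := mul_le_mul_of_nonneg_left (show s t ≤ 5 / 4 by linarith [hs'.2]) hα.le
        linarith
      have hcs2 : 0 ≤ 2 * α * s t := by
        have : 0 ≤ s t := by linarith [hs'.1]
        positivity
      have hnew : t + 1 ≤ T → e (t + 1) ≤ ε + 240 * ε * (ε * (α * (t + 1 : ℕ))) ∧
          f (t + 1) ≤ ε + 240 * ε * (ε * (α * (t + 1 : ℕ))) := fun htT => by
        have h := i4 (by omega)
        have h2 := hearly (by omega)
        set B := ε + 240 * ε * (ε * (α * t)) with hB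
        have hg2e : g ≤ 2 * ε := max_le (h.1.trans h2) (h.2.trans h2)
        have hgsq : 60 * α * g ^ 2 ≤ 60 * α * (2 * ε) ^ 2 := by gcongr
        have q1 := mul_le_mul_of_nonneg_left h.1 hcs
        have q2 := mul_le_mul_of_nonneg_left h.2 hcs2
        have q3 := mul_le_mul_of_nonneg_left h.2 hcs
        have q4 := mul_le_mul_of_nonneg_left h.1 hcs2
        have hB' : ε + 240 * ε * (ε * (α * (t + 1 : ℕ))) = B + 60 * α * (2 * ε) ^ 2 := by
          rw [hB]; push_cast; ring
        rw [hB']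
        constructor <;> linarith
      refine ⟨?_, ?_, ?_, ?_, hnew, fun hTt => ?_, sp⟩
      -- Size and gap have each drifted by at most `lam/16`, so `s - κ ≥ 3 lam/8`; the quadratic
      -- loss costs only `α lam/4`.
      · have hfac : 1 - 2 * α * (s t - κ t) + 60 * α * g ≤ ρ := by
          have : α * (3 / 8 * lam) ≤ α * (s t - κ t) := by
            gcongr
            linarith [hs16.1]
          rw [hρ]
          linarith
        calc N (t + 1) ≤ ρ * N t := sN.trans (mul_le_mul_of_nonneg_right hfac (hNn t))
          _ ≤ ρ * (2 * ε * ρ ^ t) := by gcongr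
          _ = _ := by ring
      · rw [hDstep]
        have := abs_add_le (s (t + 1) - s t) (s t - 1)
        rw [sub_add_sub_cancel] at this
        linarith
      · rw [hκs]; positivity
      · rw [hκs, hDstep]; linarith
      · rcases Nat.lt_or_ge t T with h | h
        · have hEq : t + 1 = T := by omega
          have h1 := (hnew hEq.le).2
          have : ε * (α * (t + 1 : ℕ)) ≤ 1 / 240 := by rw [hEq]; linarith
          have : 240 * ε * (ε * (α * (t + 1 : ℕ))) ≤ 240 * ε * (1 / 240) := by gcongr
          rw [hEq, Nat.sub_self, pow_zero, ← hEq]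
          linarith
        -- In the late phase the recursion pulls `f` towards `e`. The room between the bounds `2x`
        -- on `e` and `6x` on `f` yields a decrease of at least `4αx`, more than the `(3/2) α lam x`
        -- that the factor `ρ` demands.
        · have h1 := hlate h
          have h2 := i5 h
          rw [Nat.succ_sub h, pow_succ]
          have hx : 0 ≤ ε * ρ ^ (t - T) := by positivity
          have hgef : g ≤ e t + f t := max_le (by linarith [hf0 t]) (by linarith [he0 t])
          have hgg : 60 * α * g ^ 2 ≤ α / 4 * (e t + f t) := by
            have : 60 * g * g ≤ 1 / 4 * (e t + f t) := by
              apply mul_le_mul _ hgef hg0 (by norm_num)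
              linarith
            have := mul_le_mul_of_nonneg_left this hα.le
            linarith
          set x := ε * ρ ^ (t - T)
          have h1' : e t ≤ 2 * x := by linarith
          have h2' : f t ≤ 6 * x := by linarith
          have q1 := mul_le_mul_of_nonneg_left h2' hcs
          have q2 := mul_le_mul_of_nonneg_left h1' hcs2
          have q3 := mul_le_mul_of_nonneg_left h1' hα.le
          have q4 := mul_le_mul_of_nonneg_left h2' hα.le
          have hαx : 0 ≤ α * x := by positivity
          have q5 : α * x * (3 / 4) ≤ α * x * s t := by
            gcongr
            linarith [hs'.1]
          have q6 : α * x * lam ≤ α * x * 1 := by gcongr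
          have goal : 6 * ε * (ρ ^ (t - T) * ρ) = 6 * x - 3 / 2 * (α * x * lam) := by
            simp only [x, hρ]; ring
          rw [goal]
          linarith
  obtain ⟨iN, is, -, -, -, -, ip⟩ := inv t
  exact ⟨iN, by linarith [hDle t], ip⟩

end Dynamics

/-! ### Application to gradient descent. -/

section Main

variable {k m n : ℕ}

lemma opNorm_errors_le_of_errorNorm_le {A : Operator k m n} (hm : 0 < m) (hn : 0 < n) {c : ℝ}
    (h : √((m : ℝ) + n) * errorNorm A ≤ c) : ‖errorE A‖ ≤ c ∧ ‖errorF A‖ ≤ c := by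
  have hN := errorNorm_nonneg A
  constructor
  · refine (opNorm_le_fro _).trans ((fro_errorE_le A hm).trans (le_trans ?_ h))
    gcongr
    simp
  · refine (opNorm_le_fro _).trans ((fro_errorF_le A hn).trans (le_trans ?_ h))
    gcongr
    simp

lemma HasSpectralGap.le_one {lam : ℝ} {A : Operator k m n} (hm : 0 < m) (hn : 0 < n)
    (hs : 0 < size A) (h : HasSpectralGap lam A) : lam ≤ 1 := by
  have h1 := (LinearMap.singularValues_nonneg _ 1).trans h
  have hm' : (0 : ℝ) < m := Nat.cast_pos.2 hm
  have hn' : (0 : ℝ) < n := Nat.cast_pos.2 hn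
  have h2 : 0 < size A / √((m : ℝ) * n) := by positivity
  linarith [nonneg_of_mul_nonneg_left h1 h2]

/-- Along gradient descent the error decays geometrically, the size stays bounded away from zero, and
all iterates are scalings of the input. -/
theorem gradientDescent_errorNorm_le {A : Operator k m n} {ε lam α : ℝ} (hm : 2 ≤ m) (hn : 2 ≤ n)
    (hs : 0 < size A) (hlam : 0 < lam) (hA : IsNearlyDoublyBalanced ε A)
    (hgap : HasSpectralGap lam A) (hC : 100000 * ε * Real.log m ≤ lam ^ 2) (hα : 0 < α)
    (hα1 : α ≤ 1 / 8) (t : ℕ) :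
    errorNorm (gradientDescent α A t) ≤ 2 * ε * (1 - α * lam / 4) ^ t ∧
      |size (gradientDescent α A t) - 1| ≤ 1 / 4 ∧ IsScaling A (gradientDescent α A t) := by
  have hm0 : 0 < m := by omega
  have hn0 : 0 < n := by omega
  have hm' : (0 : ℝ) < m := Nat.cast_pos.2 hm0
  have hlam1 := hgap.le_one hm0 hn0 hs
  have hε := hA.nonneg hs hm0
  have hE := norm_errorE_le_of_isNearlyDoublyBalanced hm0 hA hε
  have hF := norm_errorF_le_of_isNearlyDoublyBalanced hn0 hA hε
  have hL : 1 / 2 ≤ Real.log m := by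
    have : Real.log 2 ≤ Real.log m := Real.log_le_log (by norm_num) (by exact_mod_cast hm)
    linarith [Real.log_two_gt_d9]
  have hE0 := norm_errorE_normalize_le hs hE
  have hF0 := norm_errorF_normalize_le hs hF
  set B : ℕ → Operator k m n := gradientDescent α A with hB
  have hB0 : B 0 = normalize A := rfl
  have hBs : ∀ t, B (t + 1) = gradientStep α (B t) := fun t => Function.iterate_succ_apply' _ _ _
  let g : ℕ → ℝ := fun t => max ‖errorE (B t)‖ ‖errorF (B t)‖
  let κ : ℕ → ℝ := fun t => 1 - lam / 2 + ∑ j ∈ Finset.range t, 60 * α * g j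
  have hgap0 : GapBound (1 - lam / 2) (normalize A) :=
    gapBound_normalize hs (gapBound_of_hasSpectralGap A hm0 hn hlam1 hlam.le hε
      (by nlinarith) hE hF hgap)
  -- `M = √m = exp (log m / 2)` compares `‖E‖` with the weighted norm. The predicate `p` carries the
  -- drifting gap bound and the scaling property through the induction.
  have main := linear_convergence (s := fun t => size (B t)) (e := fun t => ‖errorE (B t)‖)
    (f := fun t => ‖errorF (B t)‖) (N := fun t => errorNorm (B t)) (κ := κ) (M := √m)
    (p := fun t => GapBound (κ t) (B t) ∧ IsScaling A (B t))
    hα hα1 hlam hlam1 hε hL hC (Real.sqrt_nonneg _)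
    (by rw [Real.exp_half, Real.exp_log hm']) (fun _ => norm_nonneg _) (fun _ => norm_nonneg _)
    (fun t => (opNorm_le_fro _).trans (fro_errorE_le _ hm0)) (size_normalize hs) hE0 hF0
    (errorNorm_le hm0 hn0 hE0 hF0) (fun _ => errorNorm_nonneg _) (by simp [κ])
    (fun t => by simp only [κ, Finset.sum_range_succ, g, add_assoc])
    ⟨by simpa [κ, hB0] using hgap0, isScaling_normalize hs⟩ ?_ t
  · exact ⟨main.1, main.2.1, main.2.2.2⟩
  · intro t ht hgt hκ ⟨hpG, hpS⟩
    have hst := abs_le.1 ht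
    have hc : IsControlled α (max ‖errorE (B t)‖ ‖errorF (B t)‖) (B t) :=
      ⟨hα.le, hα1, hm0, hn0, by linarith, by linarith, hgt, le_max_left _ _, le_max_right _ _⟩
    simp only [hBs]
    refine ⟨hc.errorNorm_gradientStep_le hκ hpG, hc.norm_errorE_gradientStep_le,
      hc.norm_errorF_gradientStep_le, hc.abs_size_gradientStep_sub_le.trans ?_, ?_,
      hpS.gradientStep hc⟩
    · gcongr
      norm_num
    · have : κ (t + 1) = κ t + 60 * α * g t := by simp only [κ, Finset.sum_range_succ, add_assoc]
      rw [this]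
      exact hc.gapBound_gradientStep hpG

end Main

end OperatorScaling

theorem corollaryc :
    ∃ C c K : ℝ, 0 < C ∧ 0 < c ∧ 0 < K ∧
      ∀ (k m n : ℕ) (A : OperatorScaling.Operator k m n) (ε lam : ℝ),
        2 ≤ m → m ≤ n →
        0 < OperatorScaling.size A →
        0 < lam →
        OperatorScaling.IsNearlyDoublyBalanced ε A →
        OperatorScaling.HasSpectralGap lam A →
        C * ε * Real.log m ≤ lam ^ 2 →
        ∀ η : ℝ, 0 < η → η ≤ 1 →
          ∃ T : ℕ,
            (T : ℝ) ≤ K * (((n : ℝ) + m) ^ 2 / lam) * Real.log (((m : ℝ) + n) / η) ∧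
            ∀ t : ℕ, T ≤ t →
              OperatorScaling.IsScaling A
                (OperatorScaling.gradientDescent (c / ((m : ℝ) + n) ^ 2) A t) ∧
              OperatorScaling.IsNearlyDoublyBalanced η
                (OperatorScaling.gradientDescent (c / ((m : ℝ) + n) ^ 2) A t) := by
  -- Decay at rate `α lam/4` with `α = 1/(8S²)` needs `32 (S²/lam) ℓ` steps; rounding up adds at
  -- most `8 (S²/lam) ℓ`, whence `40`.
  refine ⟨100000, 1 / 8, 40, by norm_num, by norm_num, by norm_num, ?_⟩
  intro k m n A ε lam hm hmn hs hlam hA hgap hC η hη hη1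
  have hm2 : (2 : ℝ) ≤ m := by exact_mod_cast hm
  have hn2 : (2 : ℝ) ≤ n := by exact_mod_cast hm.trans hmn
  have hm0 : 0 < m := by omega
  have hn0 : 0 < n := by omega
  set S : ℝ := (m : ℝ) + n with hS
  have hS4 : 4 ≤ S := by linarith
  set α : ℝ := 1 / 8 / S ^ 2 with hαdef
  have hα : 0 < α := by positivity
  have hα1 : α ≤ 1 / 8 := div_le_self (by norm_num) (by nlinarith)
  have hlam1 := hgap.le_one hm0 hn0 hs
  have hε := hA.nonneg hs hm0
  have hlog2 : 1 / 2 ≤ Real.log m := by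
    have : Real.log 2 ≤ Real.log m := Real.log_le_log (by norm_num) hm2
    linarith [Real.log_two_gt_d9]
  have hε1 : 50000 * ε ≤ 1 := by nlinarith
  have hSη : 4 ≤ S / η := by
    rw [le_div_iff₀ hη]; nlinarith
  set ℓ := Real.log (S / η) with hℓ
  have hℓ1 : 1 ≤ ℓ := by
    rw [hℓ, Real.le_log_iff_exp_le (by linarith)]
    linarith [Real.exp_one_lt_d9]
  have hαl : 0 < α * lam := mul_pos hα hlam
  refine ⟨⌈4 / (α * lam) * ℓ⌉₊, ?_, fun t ht => ?_⟩
  · have h1 := (Nat.ceil_lt_add_one (show 0 ≤ 4 / (α * lam) * ℓ by positivity)).le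
    have h2 : 1 ≤ 1 / (α * lam) * ℓ := by
      have : 1 ≤ 1 / (α * lam) := by
        rw [le_div_iff₀ hαl]; nlinarith
      nlinarith
    have h3 : 40 * (((n : ℝ) + m) ^ 2 / lam) * ℓ = 5 / (α * lam) * ℓ := by
      rw [add_comm (n : ℝ) m, ← hS, hαdef]
      field_simp
      norm_num
    rw [h3]
    calc _ ≤ 4 / (α * lam) * ℓ + 1 / (α * lam) * ℓ := by linarith
      _ = _ := by ring
  · obtain ⟨hN, hsz, hsc⟩ := OperatorScaling.gradientDescent_errorNorm_le hm (hm.trans hmn) hs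
      hlam hA hgap hC hα hα1 t
    refine ⟨hsc, ?_⟩
    set B := OperatorScaling.gradientDescent α A t
    have hsz' := (abs_le.1 hsz).1
    have ht' : ℓ ≤ α * lam / 4 * t := by
      have h1 := Nat.ceil_le.1 ht
      calc ℓ = α * lam / 4 * (4 / (α * lam) * ℓ) := by field_simp
        _ ≤ _ := by gcongr
    have hexp : (1 - α * lam / 4) ^ t ≤ η / S := by
      refine (OperatorScaling.one_sub_pow_le_exp (by nlinarith) t).trans ?_
      calc Real.exp (-(α * lam / 4 * t)) ≤ Real.exp (-ℓ) := Real.exp_le_exp.2 (by linarith)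
        _ = η / S := by rw [Real.exp_neg, hℓ, Real.exp_log (by positivity), inv_div]
    have hsqrt : √S ≤ S := by
      rw [Real.sqrt_le_left (by linarith)]; nlinarith
    -- Here the crude passage from Frobenius to operator norm is harmless: the factor `√S ≤ S` is
    -- paid for by the `S` inside the logarithm.
    have hfin : √S * OperatorScaling.errorNorm B ≤ η * OperatorScaling.size B := by
      calc √S * OperatorScaling.errorNorm B ≤ S * (2 * ε * (η / S)) :=
            mul_le_mul hsqrt (hN.trans (by gcongr)) (OperatorScaling.errorNorm_nonneg B)
              (by linarith)
        _ = η * (2 * ε) := by field_simp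
        _ ≤ _ := by
            gcongr
            linarith
    obtain ⟨h1, h2⟩ := OperatorScaling.opNorm_errors_le_of_errorNorm_le hm0 hn0 hfin
    exact OperatorScaling.isNearlyDoublyBalanced_of_norm_le hm0 hn0 h1 h2
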